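/- Let $P$ be a probability measure on a measurable space $\mathcal X$ and let $k:\mathcal X\times\mathcal X\to\mathbb R$ be a kernel with $k(x,x')=\sum_{i\ge 1}\lambda_i\mu_i(x)\mu_i(x')$ for all $x,x'$, where $\lambda_1\ge\lambda_2\ge\cdots\ge 0$ and $\mu_1,\mu_2,\dots$ are the eigenvalues and the $L^2(P)$-orthonormal eigenfunctions of the integral operator $T_kf=\int k(\cdot,z)f(z)\,dP(z)$. Let $\kappa$ be such that $k(x,x)\le\kappa^2$ for $P$-almost all $x$. Let $s(\lambda)=\sum_{p\ge 1}\pi_p\lambda^p$ with $\pi_p\ge 0$, and let $R\in[0,\infty]$ be the radius of convergence of this series. Let $k_s(x,x')=\sum_i s(\lambda_i)\mu_i(x)\mu_i(x')$. Let $m\ge 0$, $n\ge 1$, and let $x_1,\dots,x_{m+n}$ be i.i.d. samples from $P$, the last $n$ of which, $\tilde x_i=x_{m+i}$, carry labels $y=(y_1,\dots,y_n)\in\mathbb R^n$. Let $G_k=(k(x_i,x_j))_{i,j\le m+n}$ and $v_k(x)=(k(x,x_i))_{i\le m+n}$, put $\hat k^1=k$ and $\hat k^p(x,x')=(m+n)^{-(p-1)}\,v_k(x)^\top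 G_k^{p-2}v_k(x')$ for $p\ge 2$, and $\hat k_s=\sum_{p\ge 1}\pi_p\hat k^p$. For $\beta_n>0$ and $K\in\{k_s,\hat k_s\}$ let $$f_K(x)=v_{K,n}(x)^\top\,(G_{K,n}+n\beta_n I_n)^{-1}y,\qquad v_{K,n}(x)=(K(x,\tilde x_i))_{i\le n},\quad G_{K,n}=(K(\tilde x_i,\tilde x_j))_{i,j\le n},$$ be the kernel ridge regression predictor with kernel $K$, and write $\tilde f=f_{k_s}$ and $\hat f=f_{\hat k_s}$. Let $\hat\lambda_1$ be the largest eigenvalue of $G_k/(m+n)$ and $\lambda_{\max}=\max\{\lambda_1,\hat\lambda_1\}$. Then, for every $\delta\in(0,1)$, with probability at least $1-\delta$ over $x_1,\dots,x_{m+n}$ the following holds, simultaneously for all $y\in\mathbb R^n$: if $\lambda_{\max}<R$ (which is automatic when $R=\infty$), then $$\|\hat f-\tilde f\|_{L^2(P)}^2\le 8\,s(\lambda_{\max})\left.\frac{d}{d\lambda}\left(\frac{s(\lambda)}{\lambda}\right)\right|_{\lambda=\lambda_{\max}}\frac{\beta_n^{-2}\kappa^4}{\sqrt{m+n}}\left(2+\sqrt{2\log\frac1\delta}\right)\frac{\|y\|_2^2}{n},$$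 where the right-hand side is read as $0$ if $\lambda_{\max}=0$. -/

import Mathlib

open MeasureTheory Matrix

noncomputable section

namespace STKR

variable {X : Type*}

/-- Spectral data of the integral operator `T_k f = ∫ k(·, z) f(z) dP(z)` on `L²(P)`:
`lam 0 ≥ lam 1 ≥ ⋯ ≥ 0` are the eigenvalues with orthonormal eigenfunctions `e 0, e 1, …`, and
`k(x, z) = ∑ i, lam i * e i x * e i z` holds pointwise. Orthonormality and the eigenvalue equation
are only required where `lam i ≠ 0`, so that finite rank kernels and finite-dimensional `L²(P)`
are included (pad `lam` by zeros). -/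
structure IsSpectralExpansion [MeasurableSpace X] (P : Measure X) (k : X → X → ℝ)
    (lam : ℕ → ℝ) (e : ℕ → X → ℝ) : Prop where
  nonneg : ∀ i, 0 ≤ lam i
  antitone : Antitone lam
  measurable : ∀ i, Measurable (e i)
  memLp : ∀ i, MemLp (e i) 2 P
  orthonormal : ∀ i j, lam i ≠ 0 → lam j ≠ 0 →
    ∫ x, e i x * e j x ∂P = if i = j then 1 else 0
  eigen : ∀ i, lam i ≠ 0 → ∀ᵐ x ∂P, ∫ z, k x z * e i z ∂P = lam i * e i x
  hasSum : ∀ x z, HasSum (fun i => lam i * e i x * e i z) (k x z)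

/-- `s(t) = ∑_{p ≥ 1} c_p t^p` (the value `c 0` is never used). -/
def transform (c : ℕ → ℝ) (t : ℝ) : ℝ := ∑' p : ℕ, c (p + 1) * t ^ (p + 1)

/-- `t` lies strictly inside the disc of convergence of `∑_{p ≥ 1} c_p t^p`
(for `t ≥ 0` and `c_p ≥ 0`). -/
def InsideConvergence (c : ℕ → ℝ) (t : ℝ) : Prop :=
  ∃ r : ℝ, t < r ∧ Summable fun p : ℕ => c (p + 1) * r ^ (p + 1)

/-- The spectrally transformed kernel `k_s(x, z) = ∑ i, s(lam i) * e i x * e i z`. -/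
def stk (s : ℝ → ℝ) (lam : ℕ → ℝ) (e : ℕ → X → ℝ) (x z : X) : ℝ :=
  ∑' i, s (lam i) * e i x * e i z

/-- The Gram matrix of a kernel on a finite family of points. -/
def gram {N : ℕ} (k : X → X → ℝ) (x : Fin N → X) : Matrix (Fin N) (Fin N) ℝ :=
  Matrix.of fun i j => k (x i) (x j)

/-- The vector `v_k(z)`, with entries `k(z, x_i)`. -/
def kvec {N : ℕ} (k : X → X → ℝ) (x : Fin N → X) (z : X) : Fin N → ℝ :=
  fun i => k z (x i)

/-- The Monte Carlo estimate of the power kernel `k^p`, `p ≥ 1`: it is `k` for `p = 1` and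
`v_k(u)ᵀ G_k^(p-2) v_k(w) / N^(p-1)` for `p ≥ 2`. The value at `p = 0` is never used. -/
def empiricalPower {N : ℕ} (k : X → X → ℝ) (x : Fin N → X) : ℕ → X → X → ℝ
  | 0 => fun _ _ => 0
  | 1 => k
  | p + 2 => fun u w =>
      (kvec k x u ⬝ᵥ ((gram k x) ^ p *ᵥ kvec k x w)) / (N : ℝ) ^ (p + 1)

/-- The estimate of `k_s`: the sum over `p ≥ 1` of `c_p` times the estimate of `k^p`. -/
def empiricalStk {N : ℕ} (c : ℕ → ℝ) (k : X → X → ℝ) (x : Fin N → X) (u w : X) : ℝ :=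
  ∑' p : ℕ, c (p + 1) * empiricalPower k x (p + 1) u w

/-- The kernel ridge regression predictor `z ↦ v_{K,n}(z)ᵀ (G_{K,n} + n β I)⁻¹ y`. -/
def krr {n : ℕ} (K : X → X → ℝ) (β : ℝ) (x : Fin n → X) (y : Fin n → ℝ) (z : X) : ℝ :=
  kvec K x z ⬝ᵥ
    ((gram K x + ((n : ℝ) * β) • (1 : Matrix (Fin n) (Fin n) ℝ))⁻¹ *ᵥ y)

/-- The largest (real) eigenvalue of a square matrix, here a symmetric one. -/
def largestEigenvalue {N : ℕ} (A : Matrix (Fin N) (Fin N) ℝ) : ℝ :=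
  sSup {t : ℝ | Module.End.HasEigenvalue (Matrix.toLin' A) t}

/-- `max {λ₁, λ̂₁}`, with `λ̂₁` the largest eigenvalue of `G_k / N`. -/
def lamMax {N : ℕ} (k : X → X → ℝ) (lam₁ : ℝ) (x : Fin N → X) : ℝ :=
  max lam₁ (largestEigenvalue ((N : ℝ)⁻¹ • gram k x))

/-- The labeled points, which are the last `n` of the `m + n` samples. -/
def labeled {m n : ℕ} (x : Fin (m + n) → X) : Fin n → X := fun i => x (Fin.natAdd m i)

end STKR

end

/-!
The features `φ(x) = (√λᵢ eᵢ(x))ᵢ` in `ℓ²` represent the kernel, `k(x, z) = ⟨φ(x), φ(z)⟩`. Let `T`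
be their covariance operator, whose nonzero eigenvalues are the `λᵢ ≠ 0`, and `T̂` the covariance
operator of the `m + n` samples, whose norm is at most the largest eigenvalue of `G_k / (m + n)`.
With `g(t) = s(t) / t`, the kernels `k_s` and `k̂_s` are `⟨φ(x), S φ(z)⟩` for `S = g(T)` and
`⟨φ(x), Ŝ φ(z)⟩` for `Ŝ = g(T̂)`.

McDiarmid's inequality and a second moment bound, in the Hilbert space of Hilbert–Schmidt
operators, control `‖T̂ - T‖`. Comparing power series termwise gives
`‖Ŝ - S‖ ≤ g'(λ_max) ‖T̂ - T‖`.

The predictors are `f̃ = ⟨φ, S v⟩` and `f̂ = ⟨φ, Ŝ u⟩`, where `v` and `u` combine the sample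
features with the ridge coefficients, so `‖f̂ - f̃‖²` is the quadratic form of `T` at
`Ŝ u - S v = (Ŝ - S) u + S (u - v)`. Subtracting the two ridge equations bounds the form
`⟨u - v, S (u - v)⟩` by `⟨u - v, (S - Ŝ) u⟩`, and `‖S (u - v)‖² ≤ ‖S‖ ⟨u - v, S (u - v)⟩`. The
quadratic forms at both summands are thus linear in `‖Ŝ - S‖`, with the factor
`λ_max g(λ_max) = s(λ_max)`.
-/

namespace STKR

section Concentration

open ProbabilityTheory
open scoped NNReal

lemma hasSubgaussianMGF_add_prod {α β : Type*} [MeasurableSpace α] [MeasurableSpace β]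
    {μ : Measure α} {ν : Measure β} [SFinite μ] [SFinite ν] {g : α → ℝ} {h : α × β → ℝ}
    {c₁ c₂ : ℝ≥0} (hg : HasSubgaussianMGF g c₁ μ) (hhm : AEStronglyMeasurable h (μ.prod ν))
    (hh : ∀ x, HasSubgaussianMGF (fun y => h (x, y)) c₂ ν) :
    HasSubgaussianMGF (fun z => g z.1 + h z) (c₁ + c₂) (μ.prod ν) := by
  have exp_add : ∀ t x y, Real.exp (t * (g x + h (x, y))) =
      Real.exp (t * g x) * Real.exp (t * h (x, y)) := fun t x y => by
    rw [mul_add, Real.exp_add]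
  have inner_le : ∀ t x, ∫ y, Real.exp (t * (g x + h (x, y))) ∂ν ≤
      Real.exp (t * g x) * Real.exp (c₂ * t ^ 2 / 2) := fun t x => by
    simp_rw [exp_add, integral_const_mul]
    exact mul_le_mul_of_nonneg_left ((hh x).mgf_le t) (Real.exp_pos _).le
  have integrable_exp : ∀ t, Integrable (fun z => Real.exp (t * (g z.1 + h z))) (μ.prod ν) := by
    intro t
    have hmeas : AEStronglyMeasurable (fun z => Real.exp (t * (g z.1 + h z))) (μ.prod ν) :=
      Real.continuous_exp.comp_aestronglyMeasurable
        ((hg.aestronglyMeasurable.comp_fst.add hhm).const_mul t)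
    refine (integrable_prod_iff hmeas).2 ⟨.of_forall fun x => ?_,
      ((hg.integrable_exp_mul t).mul_const (Real.exp (c₂ * t ^ 2 / 2))).mono'
        hmeas.norm.integral_prod_right' (.of_forall fun x => ?_)⟩
    · simp_rw [exp_add]
      exact ((hh x).integrable_exp_mul t).const_mul _
    · simp only [Real.norm_eq_abs, Real.abs_exp]
      rw [abs_of_nonneg (integral_nonneg fun y => (Real.exp_pos _).le)]
      exact inner_le t x
  refine ⟨integrable_exp, fun t => ?_⟩
  calc ∫ z, Real.exp (t * (g z.1 + h z)) ∂μ.prod ν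
      = ∫ x, ∫ y, Real.exp (t * (g x + h (x, y))) ∂ν ∂μ := integral_prod _ (integrable_exp t)
    _ ≤ ∫ x, Real.exp (t * g x) * Real.exp (c₂ * t ^ 2 / 2) ∂μ :=
        integral_mono (integrable_exp t).integral_prod_left
          ((hg.integrable_exp_mul t).mul_const _) (inner_le t)
    _ ≤ Real.exp (c₁ * t ^ 2 / 2) * Real.exp (c₂ * t ^ 2 / 2) := by
        rw [integral_mul_const]
        exact mul_le_mul_of_nonneg_right (hg.mgf_le t) (Real.exp_pos _).le
    _ = Real.exp ((c₁ + c₂ : ℝ≥0) * t ^ 2 / 2) := by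
        rw [← Real.exp_add]
        push_cast
        ring_nf

lemma hasSubgaussianMGF_of_forall_sub_le {α : Type*} [MeasurableSpace α] {μ : Measure α}
    [IsProbabilityMeasure μ] {f : α → ℝ} (hf : AEMeasurable f μ) {b : ℝ≥0}
    (hb : ∀ x y, f x - f y ≤ b) :
    HasSubgaussianMGF (fun x => f x - ∫ y, f y ∂μ) ((b / 2) ^ 2) μ := by
  have : Nonempty α := μ.nonempty_of_neZero
  have hbdd : BddBelow (Set.range f) :=
    ⟨f this.some - b, by rintro _ ⟨x, rfl⟩; linarith [hb this.some x]⟩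
  have hmem : ∀ x, f x ∈ Set.Icc (⨅ y, f y) ((⨅ y, f y) + b) := fun x =>
    ⟨ciInf_le hbdd x, sub_le_iff_le_add.1 (le_ciInf fun y => by linarith [hb x y])⟩
  convert hasSubgaussianMGF_of_mem_Icc hf (.of_forall hmem) using 2
  simp

lemma hasSubgaussianMGF_sub_integral_prod {α β : Type*} [MeasurableSpace α] [MeasurableSpace β]
    {μ : Measure α} {ν : Measure β} [IsProbabilityMeasure μ] [IsProbabilityMeasure ν]
    {F : α × β → ℝ} (hF : Integrable F (μ.prod ν))
    (hF_right : ∀ x, Integrable (fun y => F (x, y)) ν)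
    {b v : ℝ≥0} (hb : ∀ x x' y, F (x, y) - F (x', y) ≤ b)
    (hv : ∀ x, HasSubgaussianMGF (fun y => F (x, y) - ∫ y, F (x, y) ∂ν) v ν) :
    HasSubgaussianMGF (fun z => F z - ∫ z, F z ∂μ.prod ν) ((b / 2) ^ 2 + v) (μ.prod ν) := by
  have hmean : AEStronglyMeasurable (fun x => ∫ y, F (x, y) ∂ν) μ :=
    hF.integral_prod_left.aestronglyMeasurable
  have hleft := hasSubgaussianMGF_of_forall_sub_le hmean.aemeasurable fun x x' => by
    rw [← integral_sub (hF_right x) (hF_right x')]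
    simpa using integral_mono ((hF_right x).sub (hF_right x')) (integrable_const (b : ℝ)) (hb x x')
  have hsum := hasSubgaussianMGF_add_prod hleft (h := fun z => F z - ∫ y, F (z.1, y) ∂ν)
    (hF.aestronglyMeasurable.sub hmean.comp_fst) hv
  rw [integral_prod F hF]
  simpa only [sub_add_sub_cancel'] using hsum

lemma abs_sub_le_sum_of_bounded_differences {ι : Type*} [Fintype ι] [DecidableEq ι]
    {E : ι → Type*} {f : (∀ i, E i) → ℝ} {b : ι → ℝ}
    (hb : ∀ x i a, |f (Function.update x i a) - f x| ≤ b i) (x y : ∀ i, E i) :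
    |f x - f y| ≤ ∑ i, b i := by
  have h : ∀ s : Finset ι, |f (s.piecewise x y) - f y| ≤ ∑ i ∈ s, b i := fun s => by
    induction s using Finset.induction with
    | empty => simp
    | insert j s hj ih =>
      rw [Finset.piecewise_insert, Finset.sum_insert hj]
      exact (abs_sub_le _ _ _).trans (add_le_add (hb _ _ _) ih)
  simpa using h Finset.univ

lemma integrable_of_bounded_differences {ι : Type*} [Finite ι] [DecidableEq ι]
    {E : ι → Type*} [MeasurableSpace (∀ i, E i)] {μ : Measure (∀ i, E i)} [IsFiniteMeasure μ]
    {f : (∀ i, E i) → ℝ} (hf : AEStronglyMeasurable f μ) {b : ι → ℝ}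
    (hb : ∀ x i a, |f (Function.update x i a) - f x| ≤ b i) : Integrable f μ := by
  cases nonempty_fintype ι
  rcases isEmpty_or_nonempty (∀ i, E i) with _ | ⟨⟨y⟩⟩
  · rw [μ.eq_zero_of_isEmpty]
    exact integrable_zero_measure
  · refine .of_bound hf (∑ i, b i + |f y|) (.of_forall fun x => ?_)
    rw [Real.norm_eq_abs]
    linarith [abs_sub_le_sum_of_bounded_differences hb x y, abs_sub_abs_le_abs_sub (f x) (f y)]

lemma measurePreserving_fin_cons {N : ℕ} {E : Fin (N + 1) → Type*}
    [∀ i, MeasurableSpace (E i)] (P : ∀ i, Measure (E i)) [∀ i, SigmaFinite (P i)] :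
    MeasurePreserving (fun z => Fin.cons z.1 z.2 : E 0 × (∀ i : Fin N, E i.succ) → ∀ i, E i)
      ((P 0).prod (Measure.pi fun i => P i.succ)) (Measure.pi P) := by
  have h : ⇑(MeasurableEquiv.piFinSuccAbove E 0).symm =
      fun z : E 0 × (∀ i : Fin N, E i.succ) => Fin.cons z.1 z.2 := by
    simp only [MeasurableEquiv.piFinSuccAbove, Fin.insertNthEquiv_zero]
    rfl
  exact h ▸ (measurePreserving_piFinSuccAbove P 0).symm

lemma hasSubgaussianMGF_of_bounded_differences {N : ℕ} {E : Fin N → Type*}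
    [∀ i, MeasurableSpace (E i)] (P : ∀ i, Measure (E i)) [∀ i, IsProbabilityMeasure (P i)]
    {f : (∀ i, E i) → ℝ} (hf : Measurable f) {b : Fin N → ℝ≥0}
    (hb : ∀ x i a, |f (Function.update x i a) - f x| ≤ b i) :
    HasSubgaussianMGF (fun x => f x - ∫ y, f y ∂Measure.pi P) (∑ i, (b i / 2) ^ 2)
      (Measure.pi P) := by
  induction N with
  | zero =>
    have h : ∀ x, f x = f (fun i => i.elim0) := fun x => congrArg f (Subsingleton.elim _ _)
    simp [h]
  | succ N ih =>
    set π := Measure.pi fun i : Fin N => P i.succ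
    have hcons := measurePreserving_fin_cons P
    let F : E 0 × (∀ i : Fin N, E i.succ) → ℝ := fun z => f (Fin.cons z.1 z.2)
    have integrable_F : Integrable F ((P 0).prod π) :=
      hcons.integrable_comp_of_integrable
        (integrable_of_bounded_differences hf.aestronglyMeasurable hb)
    have hFm (a) : Measurable fun y => F (a, y) :=
      (hf.comp hcons.measurable).comp measurable_prodMk_left
    have F_head (a a' y) : F (a, y) - F (a', y) ≤ b 0 := by
      have := hb (Fin.cons a' y) 0 a
      rw [Fin.update_cons_zero] at this
      exact (le_abs_self _).trans this
    have F_tail (a y i c) : |F (a, Function.update y i c) - F (a, y)| ≤ b i.succ := by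
      simp only [F, Fin.cons_update]
      exact hb _ _ _
    have hF := hasSubgaussianMGF_sub_integral_prod integrable_F
      (fun a => integrable_of_bounded_differences (hFm a).aestronglyMeasurable (F_tail a)) F_head
      fun a => ih _ (hFm a) (F_tail a)
    rw [Fin.sum_univ_succ, ← hcons.map_eq,
      integral_map hcons.measurable.aemeasurable hf.aestronglyMeasurable]
    refine hF.congr_identDistrib ⟨hF.aemeasurable, (hf.sub_const _).aemeasurable, ?_⟩
    rw [Measure.map_map (hf.sub_const _) hcons.measurable]
    rfl

section SecondMoment

variable {Ω H : Type*} [MeasurableSpace Ω] {μ : Measure Ω}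
  [NormedAddCommGroup H] [InnerProductSpace ℝ H]

lemma integrable_inner_of_memLp_two {ξ η : Ω → H} (hξ : MemLp ξ 2 μ) (hη : MemLp η 2 μ) :
    Integrable (fun ω => inner ℝ (ξ ω) (η ω)) μ :=
  (hξ.norm.integrable_mul hη.norm).mono' (hξ.1.inner hη.1)
    (.of_forall fun ω => norm_inner_le_norm (ξ ω) (η ω))

variable [CompleteSpace H] [MeasurableSpace H] [BorelSpace H]

lemma integral_norm_sum_sq_of_indepFun [IsFiniteMeasure μ] {ι : Type*} {ξ : ι → Ω → H}
    (s : Finset ι) (hξ : ∀ i, MemLp (ξ i) 2 μ) (hind : Pairwise fun i j => IndepFun (ξ i) (ξ j) μ)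
    (h0 : ∀ i, ∫ ω, ξ i ω ∂μ = 0) :
    ∫ ω, ‖∑ i ∈ s, ξ i ω‖ ^ 2 ∂μ = ∑ i ∈ s, ∫ ω, ‖ξ i ω‖ ^ 2 ∂μ := by
  have hint i j := integrable_inner_of_memLp_two (hξ i) (hξ j)
  have inner_eq_zero : ∀ i j, i ≠ j → ∫ ω, inner ℝ (ξ i ω) (ξ j ω) ∂μ = 0 := fun i j hij => by
    have : ∫ ω, inner ℝ (ξ i ω) (ξ j ω) ∂μ = inner ℝ (∫ ω, ξ i ω ∂μ) (∫ ω, ξ j ω ∂μ) :=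
      (hind hij).integral_bilin ((hξ i).integrable one_le_two) ((hξ j).integrable one_le_two)
        (innerSL ℝ)
    rw [this, h0, inner_zero_left]
  simp_rw [← real_inner_self_eq_norm_sq, sum_inner, inner_sum]
  rw [integral_finsetSum _ fun i _ => integrable_finsetSum _ fun j _ => hint i j]
  refine Finset.sum_congr rfl fun i hi => ?_
  rw [integral_finsetSum _ fun j _ => hint i j]
  exact Finset.sum_eq_single_of_mem i hi fun j _ hij => inner_eq_zero i j hij.symm

end SecondMoment

lemma sq_integral_le_integral_sq {Ω : Type*} [MeasurableSpace Ω] {μ : Measure Ω}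
    [IsProbabilityMeasure μ] {f : Ω → ℝ} (hf : MemLp f 2 μ) :
    (∫ ω, f ω ∂μ) ^ 2 ≤ ∫ ω, f ω ^ 2 ∂μ := by
  have h := variance_nonneg f μ
  rw [variance_eq_sub hf] at h
  exact sub_nonneg.1 h

section EmpiricalMean

variable {X H : Type*} [MeasurableSpace X] {P : Measure X}
  [NormedAddCommGroup H] [InnerProductSpace ℝ H] {N : ℕ}

lemma average_sub_eq_average_sub (hN : 0 < N) (h : H) (u : Fin N → H) :
    (N : ℝ)⁻¹ • ∑ i, u i - h = (N : ℝ)⁻¹ • ∑ i, (u i - h) := by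
  have hN' : (N : ℝ) ≠ 0 := Nat.cast_ne_zero.2 hN.ne'
  simp [Finset.sum_sub_distrib, smul_sub, ← Nat.cast_smul_eq_nsmul ℝ, smul_smul, hN']

variable [IsProbabilityMeasure P] [CompleteSpace H] {ψ : X → H} {M : ℝ}

lemma integral_norm_sum_comp_eval_sq {ξ : X → H} (hξ : MemLp ξ 2 P) (h0 : ∫ a, ξ a ∂P = 0) :
    ∫ x, ‖∑ i, ξ (x i)‖ ^ 2 ∂(Measure.pi fun _ : Fin N => P) = N * ∫ a, ‖ξ a‖ ^ 2 ∂P := by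
  borelize H
  have heval (i : Fin N) := measurePreserving_eval (fun _ => P) i
  rw [integral_norm_sum_sq_of_indepFun (ξ := fun (i : Fin N) (x : Fin N → X) => ξ (x i))
    Finset.univ (fun i => hξ.comp_measurePreserving (heval i))
    (fun i j hij => (iIndepFun_pi fun _ => hξ.1.aemeasurable).indepFun hij)
    (fun i => (integral_comp_eval hξ.1).trans h0)]
  have hsq : AEStronglyMeasurable (fun a => ‖ξ a‖ ^ 2) P := hξ.1.norm.pow 2
  simp [integral_comp_eval (μ := fun _ : Fin N => P) hsq]

lemma integral_norm_average_sub_integral_le (hψ : AEStronglyMeasurable ψ P)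
    (hM : ∀ᵐ x ∂P, ‖ψ x‖ ≤ M) (hN : 0 < N) :
    ∫ x, ‖(N : ℝ)⁻¹ • ∑ i, ψ (x i) - ∫ a, ψ a ∂P‖ ∂(Measure.pi fun _ : Fin N => P) ≤
      2 * M / √N := by
  have hM0 : 0 ≤ M := by
    obtain ⟨x, hx⟩ := hM.exists
    exact (norm_nonneg _).trans hx
  set ξ : X → H := fun a => ψ a - ∫ a, ψ a ∂P
  have hξM : ∀ᵐ a ∂P, ‖ξ a‖ ≤ 2 * M := by
    have hmean : ‖∫ a, ψ a ∂P‖ ≤ M := by simpa using norm_integral_le_of_norm_le_const hM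
    filter_upwards [hM] with a ha using (norm_sub_le _ _).trans (by linarith)
  have hξ : MemLp ξ 2 P := .of_bound (hψ.sub aestronglyMeasurable_const) _ hξM
  have hξ0 : ∫ a, ξ a ∂P = 0 := by
    rw [integral_sub (.of_bound hψ M hM) (integrable_const _)]
    simp
  have hξ2 : ∫ a, ‖ξ a‖ ^ 2 ∂P ≤ (2 * M) ^ 2 := by
    have := integral_mono_ae hξ.norm.integrable_sq (integrable_const ((2 * M) ^ 2))
      (hξM.mono fun a ha => pow_le_pow_left₀ (norm_nonneg _) ha 2)
    simpa using this
  have hsum : MemLp (fun x : Fin N → X => ‖∑ i, ξ (x i)‖) 2 (Measure.pi fun _ => P) :=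
    (memLp_finsetSum _ fun i _ =>
      hξ.comp_measurePreserving (measurePreserving_eval (fun _ => P) i)).norm
  have hmean : ∫ x, ‖∑ i, ξ (x i)‖ ∂(Measure.pi fun _ : Fin N => P) ≤ √N * (2 * M) := by
    refine abs_le_of_sq_le_sq' ?_ (by positivity) |>.2
    calc _ ≤ _ := sq_integral_le_integral_sq hsum
      _ ≤ N * (2 * M) ^ 2 := by
        rw [integral_norm_sum_comp_eval_sq hξ hξ0]
        gcongr
      _ = _ := by rw [mul_pow √_, Real.sq_sqrt N.cast_nonneg]
  simp_rw [average_sub_eq_average_sub hN, norm_smul]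
  rw [integral_const_mul]
  calc _ ≤ ‖(N : ℝ)⁻¹‖ * (√N * (2 * M)) := by gcongr
    _ = 2 * M / √N := by
      rw [Real.norm_of_nonneg (by positivity)]
      field_simp
      rw [Real.sq_sqrt N.cast_nonneg]

lemma measureReal_norm_average_sub_integral_ge_le (hψ : StronglyMeasurable ψ)
    (hM0 : 0 ≤ M) (hM : ∀ x, ‖ψ x‖ ≤ M) (hN : 0 < N) {ε : ℝ} (hε : 0 ≤ ε) :
    (Measure.pi fun _ : Fin N => P).real
      {x | 2 * M / √N + ε ≤ ‖(N : ℝ)⁻¹ • ∑ i, ψ (x i) - ∫ a, ψ a ∂P‖} ≤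
        Real.exp (-(N * ε ^ 2) / (2 * M ^ 2)) := by
  set f : (Fin N → X) → ℝ := fun x => ‖(N : ℝ)⁻¹ • ∑ i, ψ (x i) - ∫ a, ψ a ∂P‖
  have hf : Measurable f :=
    (((Finset.stronglyMeasurable_fun_sum _ fun i _ =>
      hψ.comp_measurable (measurable_pi_apply i)).const_smul _).sub
        stronglyMeasurable_const).norm.measurable
  have hfb : ∀ x i a, |f (Function.update x i a) - f x| ≤ (2 * M / N).toNNReal := fun x i a => by
    rw [Real.coe_toNNReal _ (by positivity)]
    refine (abs_norm_sub_norm_le _ _).trans ?_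
    rw [sub_sub_sub_cancel_right, ← smul_sub, ← Finset.sum_sub_distrib, Finset.sum_eq_single i
      (fun j _ hj => by simp [Function.update_of_ne hj]) (by simp), Function.update_self, norm_smul,
      Real.norm_of_nonneg (by positivity), div_eq_inv_mul]
    gcongr
    exact (norm_sub_le _ _).trans (by linarith [hM a, hM (x i)])
  have hparam : ((∑ _i : Fin N, ((2 * M / N).toNNReal / 2) ^ 2 : ℝ≥0) : ℝ) = M ^ 2 / N := by
    have hN' : (N : ℝ) ≠ 0 := Nat.cast_ne_zero.2 hN.ne'
    push_cast
    rw [Real.coe_toNNReal _ (by positivity), Finset.sum_const, Finset.card_univ, Fintype.card_fin,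
      nsmul_eq_mul]
    field_simp
  have hmean := integral_norm_average_sub_integral_le (P := P) hψ.aestronglyMeasurable
    (.of_forall hM) hN
  calc _ ≤ (Measure.pi fun _ : Fin N => P).real
        {x | ε ≤ f x - ∫ y, f y ∂(Measure.pi fun _ : Fin N => P)} :=
        measureReal_mono fun x (hx : 2 * M / √N + ε ≤ f x) => by
          change ε ≤ f x - _
          linarith
    _ ≤ _ := (hasSubgaussianMGF_of_bounded_differences (fun _ : Fin N => P) hf hfb).measure_ge_le hε
    _ = _ := by
      rw [hparam]
      congr 1
      field_simp

lemma measureReal_lt_norm_average_sub_integral_le_of_forall (hψ : StronglyMeasurable ψ)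
    (hM : ∀ x, ‖ψ x‖ ≤ M) (hN : 0 < N) {δ : ℝ} (hδ₀ : 0 < δ) (hδ₁ : δ ≤ 1) :
    (Measure.pi fun _ : Fin N => P).real
      {x | M / √N * (2 + √(2 * Real.log (1 / δ))) <
        ‖(N : ℝ)⁻¹ • ∑ i, ψ (x i) - ∫ a, ψ a ∂P‖} ≤ δ := by
  have hM0 : 0 ≤ M := (norm_nonneg _).trans (hM P.nonempty_of_neZero.some)
  rcases hM0.eq_or_lt with rfl | hMpos
  · have hψ0 : ∀ x, ψ x = 0 := fun x => norm_le_zero_iff.1 (hM x)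
    simpa [hψ0] using hδ₀.le
  have hNpos : (0 : ℝ) < N := Nat.cast_pos.2 hN
  have hlog : 0 ≤ Real.log (1 / δ) := Real.log_nonneg (by rwa [one_le_div hδ₀])
  set ε := M / √N * √(2 * Real.log (1 / δ)) with hε
  have hsplit : M / √N * (2 + √(2 * Real.log (1 / δ))) = 2 * M / √N + ε := by rw [hε]; ring
  calc _ ≤ (Measure.pi fun _ : Fin N => P).real
        {x | 2 * M / √N + ε ≤ ‖(N : ℝ)⁻¹ • ∑ i, ψ (x i) - ∫ a, ψ a ∂P‖} := by
        rw [hsplit]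
        exact measureReal_mono (Set.ofPred_subset_ofPred.2 fun _ => le_of_lt)
    _ ≤ Real.exp (-(N * ε ^ 2) / (2 * M ^ 2)) :=
        measureReal_norm_average_sub_integral_ge_le hψ hM0 hM hN (by positivity)
    _ = Real.exp (Real.log δ) := by
        rw [hε, mul_pow, div_pow, Real.sq_sqrt hNpos.le, Real.sq_sqrt (by positivity), one_div,
          Real.log_inv]
        congr 1
        field_simp
    _ = δ := Real.exp_log hδ₀

lemma measureReal_lt_norm_average_sub_integral_le (hψ : AEStronglyMeasurable ψ P)
    (hM : ∀ᵐ x ∂P, ‖ψ x‖ ≤ M) (hN : 0 < N) {δ : ℝ} (hδ₀ : 0 < δ) (hδ₁ : δ ≤ 1) :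
    (Measure.pi fun _ : Fin N => P).real
      {x | M / √N * (2 + √(2 * Real.log (1 / δ))) <
        ‖(N : ℝ)⁻¹ • ∑ i, ψ (x i) - ∫ a, ψ a ∂P‖} ≤ δ := by
  set A := {x | ‖hψ.mk ψ x‖ ≤ M}
  set ψ' := A.indicator (hψ.mk ψ) with hψ'
  have hψ'm : StronglyMeasurable ψ' := hψ.stronglyMeasurable_mk.indicator
    (measurableSet_le hψ.stronglyMeasurable_mk.norm.measurable measurable_const)
  have hψ'M (x) : ‖ψ' x‖ ≤ M := by
    obtain ⟨x₀, hx₀⟩ := hM.exists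
    by_cases hx : x ∈ A
    · rwa [hψ', Set.indicator_of_mem hx]
    · rw [hψ', Set.indicator_of_notMem hx, norm_zero]
      exact (norm_nonneg _).trans hx₀
  have hae : ψ =ᵐ[P] ψ' := by
    filter_upwards [hM, hψ.ae_eq_mk] with x hx hmk
    have hxA : x ∈ A := (congrArg norm hmk).symm.trans_le hx
    rw [hψ', Set.indicator_of_mem hxA, hmk]
  refine le_trans (measureReal_congr ?_).le
    (measureReal_lt_norm_average_sub_integral_le_of_forall hψ'm hψ'M hN hδ₀ hδ₁ (P := P))
  have hae_pi : ∀ᵐ x ∂Measure.pi fun _ : Fin N => P, ∀ i, ψ (x i) = ψ' (x i) :=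
    Filter.eventually_all.2 fun i =>
      (Measure.quasiMeasurePreserving_eval (μ := fun _ : Fin N => P) i).ae hae
  filter_upwards [hae_pi] with x hx
  change (_ < _) = (_ < _)
  simp only [hx, integral_congr_ae hae]

end EmpiricalMean

lemma exists_measurableSet_of_measureReal_not_le {Ω : Type*} [MeasurableSpace Ω] {μ : Measure Ω}
    [IsProbabilityMeasure μ] {p : Ω → Prop} {δ : ℝ} (h : μ.real {ω | ¬p ω} ≤ δ) :
    ∃ A, MeasurableSet A ∧ 1 - δ ≤ μ.real A ∧ ∀ ω ∈ A, p ω := by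
  refine ⟨(toMeasurable μ {ω | ¬p ω})ᶜ, (measurableSet_toMeasurable _ _).compl, ?_,
    fun ω hω => not_not.1 fun hp => hω (subset_toMeasurable _ _ hp)⟩
  rw [probReal_compl_eq_one_sub (measurableSet_toMeasurable _ _), measureReal_def,
    measure_toMeasurable]
  exact sub_le_sub_left h 1

end Concentration

section Covariance

open InnerProductSpace

lemma memLp_two_of_ae_norm_sq_le {X H : Type*} [MeasurableSpace X] {P : Measure X}
    [IsFiniteMeasure P] [NormedAddCommGroup H] {φ : X → H} (hφ : AEStronglyMeasurable φ P) {κ : ℝ}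
    (hκ : ∀ᵐ x ∂P, ‖φ x‖ ^ 2 ≤ κ ^ 2) : MemLp φ 2 P :=
  .of_bound hφ |κ| (hκ.mono fun x hx => by simpa using sq_le_sq.1 hx)

variable {X H : Type*} [NormedAddCommGroup H] [InnerProductSpace ℝ H] {φ : X → H} {N : ℕ}

/-- The covariance operator `∫ φ(x) ⊗ φ(x) dP(x)` of a feature map; on the feature space it plays
the role of the integral operator of the kernel `⟨φ(x), φ(z)⟩`. -/
noncomputable def covariance [MeasurableSpace X] (P : Measure X) (φ : X → H) : H →L[ℝ] H :=
  ∫ x, rankOne ℝ (φ x) (φ x) ∂P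

/-- The covariance operator of a feature map with respect to the empirical measure of a sample;
on the feature space it plays the role of the normalized Gram matrix. -/
noncomputable def empiricalCovariance (φ : X → H) (x : Fin N → X) : H →L[ℝ] H :=
  (N : ℝ)⁻¹ • ∑ i, rankOne ℝ (φ (x i)) (φ (x i))

lemma empiricalCovariance_apply (φ : X → H) (x : Fin N → X) (v : H) :
    empiricalCovariance φ x v = (N : ℝ)⁻¹ • ∑ i, inner ℝ (φ (x i)) v • φ (x i) := by
  simp [empiricalCovariance]

lemma inner_empiricalCovariance_apply (φ : X → H) (x : Fin N → X) (u v : H) :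
    inner ℝ u (empiricalCovariance φ x v) =
      (N : ℝ)⁻¹ * ∑ i, inner ℝ (φ (x i)) u * inner ℝ (φ (x i)) v := by
  simp [empiricalCovariance_apply, inner_sum, inner_smul_right, real_inner_comm, mul_comm]

lemma isPositive_empiricalCovariance (φ : X → H) (x : Fin N → X) :
    (empiricalCovariance φ x).IsPositive :=
  (ContinuousLinearMap.isPositive_sum _ fun i _ => isPositive_rankOne_self (φ (x i))).smul_of_nonneg
    (by positivity)

/-- The tensor `u ⊗ v` in the Hilbert space of Hilbert–Schmidt operators, which is encoded as the
completion of the algebraic tensor product. Concentration of averages holds in a Hilbert space, and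
is transferred to operators by bounding the operator norm by the Hilbert–Schmidt norm. -/
noncomputable def hilbertTensor (u v : H) : UniformSpace.Completion (TensorProduct ℝ H H) :=
  (TensorProduct.tmul ℝ u v : TensorProduct ℝ H H)

lemma inner_hilbertTensor (a b u v : H) :
    inner ℝ (hilbertTensor a b) (hilbertTensor u v) = inner ℝ a u * inner ℝ b v := by
  simp [hilbertTensor, UniformSpace.Completion.inner_coe]

lemma norm_hilbertTensor (u v : H) : ‖hilbertTensor u v‖ = ‖u‖ * ‖v‖ := by
  simp [hilbertTensor, UniformSpace.Completion.norm_coe]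

lemma continuous_hilbertTensor_self : Continuous fun u : H => hilbertTensor u u :=
  (UniformSpace.Completion.continuous_coe _).comp
    (TensorProduct.continuous_tmul.comp (continuous_id.prodMk continuous_id))

variable [MeasurableSpace X] {P : Measure X}

lemma integrable_rankOne_self (hφ : MemLp φ 2 P) :
    Integrable (fun x => rankOne ℝ (φ x) (φ x)) P := by
  have hcont : Continuous fun v : H => rankOne ℝ v v :=
    (rankOne (E := H) (F := H) ℝ).continuous₂.comp (continuous_id.prodMk continuous_id)
  refine hφ.norm.integrable_sq.mono' (hcont.comp_aestronglyMeasurable hφ.1)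
    (.of_forall fun x => ?_)
  rw [norm_rankOne, sq]

lemma integrable_hilbertTensor_self (hφ : MemLp φ 2 P) :
    Integrable (fun x => hilbertTensor (φ x) (φ x)) P := by
  refine hφ.norm.integrable_sq.mono' (continuous_hilbertTensor_self.comp_aestronglyMeasurable hφ.1)
    (.of_forall fun x => ?_)
  rw [norm_hilbertTensor, sq]

variable [CompleteSpace H]

lemma inner_covariance_apply (hφ : MemLp φ 2 P) (u v : H) :
    inner ℝ u (covariance P φ v) = ∫ x, inner ℝ (φ x) u * inner ℝ (φ x) v ∂P := by
  have hint := integrable_rankOne_self hφ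
  rw [covariance, ContinuousLinearMap.integral_apply hint,
    ← integral_inner (hint.apply_continuousLinearMap v)]
  simp [inner_smul_right, real_inner_comm, mul_comm]

lemma isPositive_covariance (hφ : MemLp φ 2 P) : (covariance P φ).IsPositive := by
  refine (ContinuousLinearMap.isPositive_iff _).2 ⟨fun u v => ?_, fun u => ?_⟩
  · simp only [ContinuousLinearMap.coe_coe]
    rw [real_inner_comm, inner_covariance_apply hφ, inner_covariance_apply hφ]
    simp_rw [mul_comm]
  · rw [real_inner_comm, inner_covariance_apply hφ]
    exact integral_nonneg fun x => mul_self_nonneg _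

lemma norm_empiricalCovariance_sub_covariance_le (hφ : MemLp φ 2 P) (x : Fin N → X) :
    ‖empiricalCovariance φ x - covariance P φ‖ ≤
      ‖(N : ℝ)⁻¹ • ∑ i, hilbertTensor (φ (x i)) (φ (x i)) -
        ∫ a, hilbertTensor (φ a) (φ a) ∂P‖ := by
  refine ContinuousLinearMap.opNorm_le_of_re_inner_le (norm_nonneg _) fun v u hv hu => ?_
  have hcoeff : inner ℝ u ((empiricalCovariance φ x - covariance P φ) v) =
      inner ℝ (hilbertTensor u v) ((N : ℝ)⁻¹ • ∑ i, hilbertTensor (φ (x i)) (φ (x i)) -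
        ∫ a, hilbertTensor (φ a) (φ a) ∂P) := by
    rw [_root_.sub_apply, inner_sub_right, inner_empiricalCovariance_apply,
      inner_covariance_apply hφ, inner_sub_right,
      ← integral_inner (integrable_hilbertTensor_self hφ)]
    simp [inner_smul_right, inner_sum, inner_hilbertTensor, real_inner_comm]
  rw [RCLike.re_to_real, real_inner_comm, hcoeff]
  simpa [norm_hilbertTensor, hu, hv] using real_inner_le_norm (hilbertTensor u v)
    ((N : ℝ)⁻¹ • ∑ i, hilbertTensor (φ (x i)) (φ (x i)) - ∫ a, hilbertTensor (φ a) (φ a) ∂P)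

variable [IsProbabilityMeasure P] {κ : ℝ}

lemma measureReal_lt_norm_empiricalCovariance_sub_covariance_le (hφ : AEStronglyMeasurable φ P)
    (hκ : ∀ᵐ x ∂P, ‖φ x‖ ^ 2 ≤ κ ^ 2) (hN : 0 < N) {δ : ℝ} (hδ₀ : 0 < δ) (hδ₁ : δ ≤ 1) :
    (Measure.pi fun _ : Fin N => P).real
      {x | κ ^ 2 / √N * (2 + √(2 * Real.log (1 / δ))) <
        ‖empiricalCovariance φ x - covariance P φ‖} ≤ δ := by
  have hbound : ∀ᵐ x ∂P, ‖hilbertTensor (φ x) (φ x)‖ ≤ κ ^ 2 := hκ.mono fun x hx => by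
    rwa [norm_hilbertTensor, ← sq]
  refine (measureReal_mono (Set.ofPred_subset_ofPred.2 fun x hx => ?_)).trans
    (measureReal_lt_norm_average_sub_integral_le
      (continuous_hilbertTensor_self.comp_aestronglyMeasurable hφ) hbound hN hδ₀ hδ₁)
  exact hx.trans_le
    (norm_empiricalCovariance_sub_covariance_le (memLp_two_of_ae_norm_sq_le hφ hκ) x)

lemma exists_measurableSet_norm_empiricalCovariance_sub_covariance_le
    (hφ : AEStronglyMeasurable φ P) (hκ : ∀ᵐ x ∂P, ‖φ x‖ ^ 2 ≤ κ ^ 2) (hN : 0 < N) {δ : ℝ}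
    (hδ₀ : 0 < δ) (hδ₁ : δ ≤ 1) :
    ∃ E : Set (Fin N → X), MeasurableSet E ∧ 1 - δ ≤ (Measure.pi fun _ : Fin N => P).real E ∧
      ∀ x ∈ E, (∀ i, ‖φ (x i)‖ ^ 2 ≤ κ ^ 2) ∧ ‖empiricalCovariance φ x - covariance P φ‖ ≤
        κ ^ 2 / √N * (2 + √(2 * Real.log (1 / δ))) := by
  have hκ_pi : ∀ᵐ x ∂Measure.pi fun _ : Fin N => P, ∀ i, ‖φ (x i)‖ ^ 2 ≤ κ ^ 2 :=
    Filter.eventually_all.2 fun i =>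
      (Measure.quasiMeasurePreserving_eval (μ := fun _ : Fin N => P) i).ae hκ
  refine exists_measurableSet_of_measureReal_not_le (le_trans (measureReal_congr ?_).le
    (measureReal_lt_norm_empiricalCovariance_sub_covariance_le hφ hκ hN hδ₀ hδ₁))
  filter_upwards [hκ_pi] with x hx
  change (¬(_ ∧ _)) = (_ < _)
  simp only [hx, implies_true, true_and, not_le]

end Covariance

section PowerSeries

variable {c : ℕ → ℝ} {L : ℝ}

/-- The quotient `s(A) / A = ∑_{p ≥ 0} c_{p+1} A^p`, for a real number or an operator `A`. The
coefficients are indexed as in `transform`. -/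
noncomputable def quotientSeries {𝔸 : Type*} [NormedRing 𝔸] [NormedAlgebra ℝ 𝔸] (c : ℕ → ℝ)
    (A : 𝔸) : 𝔸 :=
  ∑' p : ℕ, c (p + 1) • A ^ p

/-- The termwise derivative of `∑_{p ≥ 0} c_{p+1} t^p`. It equals `(s(t) / t)'` for `t > 0`, and
unlike `deriv` of that quotient it has the right value at `t = 0`. -/
noncomputable def quotientSeriesDeriv (c : ℕ → ℝ) (t : ℝ) : ℝ :=
  ∑' p : ℕ, c (p + 1) * (p * t ^ (p - 1))

lemma InsideConvergence.mono {t : ℝ} (h : InsideConvergence c L) (ht : t ≤ L) :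
    InsideConvergence c t :=
  let ⟨r, hr, hs⟩ := h
  ⟨r, ht.trans_lt hr, hs⟩

lemma InsideConvergence.summable (hc : ∀ p, 0 ≤ c (p + 1)) (h : InsideConvergence c L)
    (hL : 0 ≤ L) : Summable fun p : ℕ => c (p + 1) * L ^ p := by
  obtain ⟨r, hr, hs⟩ := h
  have hr₀ : 0 < r := hL.trans_lt hr
  refine .of_nonneg_of_le (fun p => mul_nonneg (hc p) (by positivity)) (fun p => ?_)
    (hs.mul_right r⁻¹)
  calc c (p + 1) * L ^ p ≤ c (p + 1) * r ^ p := by gcongr; exact hc p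
    _ = c (p + 1) * r ^ (p + 1) * r⁻¹ := by field_simp; ring

lemma InsideConvergence.summable_deriv (hc : ∀ p, 0 ≤ c (p + 1)) (h : InsideConvergence c L)
    (hL : 0 ≤ L) : Summable fun p : ℕ => c (p + 1) * (p * L ^ (p - 1)) := by
  obtain ⟨r, hr, hs⟩ := h
  have hr₀ : 0 < r := hL.trans_lt hr
  have hrL : 0 < r - L := sub_pos.2 hr
  refine .of_nonneg_of_le (fun p => mul_nonneg (hc p) (by positivity)) (fun p => ?_)
    (hs.mul_right (r * (r - L))⁻¹)
  have hbernoulli : p * L ^ (p - 1) * (r - L) ≤ r ^ p := by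
    have := pow_add_mul_le_add_pow hL (by linarith : 0 ≤ 2 * L + (r - L)) p
    rw [add_sub_cancel] at this
    linarith [pow_nonneg hL p]
  calc c (p + 1) * (p * L ^ (p - 1)) ≤ c (p + 1) * (r ^ p / (r - L)) :=
        mul_le_mul_of_nonneg_left ((le_div_iff₀ hrL).2 hbernoulli) (hc p)
    _ = c (p + 1) * r ^ (p + 1) * (r * (r - L))⁻¹ := by field_simp; ring

lemma transform_eq_mul_quotientSeries (c : ℕ → ℝ) (t : ℝ) :
    transform c t = t * quotientSeries c t := by
  rw [transform, quotientSeries, ← tsum_mul_left]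
  exact tsum_congr fun p => by rw [smul_eq_mul]; ring

lemma transform_nonneg (hc : ∀ p, 0 ≤ c (p + 1)) {t : ℝ} (ht : 0 ≤ t) : 0 ≤ transform c t :=
  tsum_nonneg fun p => mul_nonneg (hc p) (by positivity)

lemma quotientSeriesDeriv_nonneg (hc : ∀ p, 0 ≤ c (p + 1)) {t : ℝ} (ht : 0 ≤ t) :
    0 ≤ quotientSeriesDeriv c t :=
  tsum_nonneg fun p => mul_nonneg (hc p) (by positivity)

lemma hasDerivAt_quotientSeries (hc : ∀ p, 0 ≤ c (p + 1)) (h : InsideConvergence c L)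
    (hL : 0 < L) : HasDerivAt (quotientSeries c) (quotientSeriesDeriv c L) L := by
  obtain ⟨r, hr, hs⟩ := h
  obtain ⟨q, hLq, hqr⟩ := exists_between hr
  have hq : InsideConvergence c q := ⟨r, hqr, hs⟩
  refine hasDerivAt_tsum_of_isPreconnected (hq.summable_deriv hc (hL.trans hLq).le)
    (t := Set.Ioo 0 q) isOpen_Ioo isPreconnected_Ioo
    (fun p t _ => (hasDerivAt_pow p t).const_mul _) (fun p t ht => ?_)
    (y₀ := L) ⟨hL, hLq⟩ ((hq.mono hLq.le).summable hc hL.le) ⟨hL, hLq⟩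
  have ht₀ : 0 ≤ t := ht.1.le
  rw [Real.norm_of_nonneg (mul_nonneg (hc p) (by positivity))]
  exact mul_le_mul_of_nonneg_left (by gcongr; exact ht.2.le) (hc p)

lemma deriv_transform_div (hc : ∀ p, 0 ≤ c (p + 1)) (h : InsideConvergence c L) (hL : 0 < L) :
    deriv (fun t => transform c t / t) L = quotientSeriesDeriv c L := by
  have heq : (fun t => transform c t / t) =ᶠ[nhds L] quotientSeries c := by
    filter_upwards [lt_mem_nhds hL] with t ht
    rw [transform_eq_mul_quotientSeries, mul_div_cancel_left₀ _ ht.ne']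
  rw [heq.deriv_eq, (hasDerivAt_quotientSeries hc h hL).deriv]

lemma transform_mul_deriv_transform_div (hc : ∀ p, 0 ≤ c (p + 1)) (h : InsideConvergence c L)
    (hL : 0 ≤ L) : transform c L * deriv (fun t => transform c t / t) L =
      transform c L * quotientSeriesDeriv c L := by
  obtain rfl | hL := hL.eq_or_lt
  · simp [transform_eq_mul_quotientSeries]
  · rw [deriv_transform_div hc h hL]

end PowerSeries

section NormedAlgebra

variable {𝔸 : Type*} [NormedRing 𝔸] [NormOneClass 𝔸] {A B : 𝔸} {c : ℕ → ℝ} {L : ℝ}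

lemma norm_pow_sub_pow_le (hA : ‖A‖ ≤ L) (hB : ‖B‖ ≤ L) (p : ℕ) :
    ‖A ^ p - B ^ p‖ ≤ p * L ^ (p - 1) * ‖A - B‖ := by
  have hL : 0 ≤ L := (norm_nonneg _).trans hA
  induction p with
  | zero => simp
  | succ p ih =>
    have hsplit : A ^ (p + 1) - B ^ (p + 1) = A ^ p * (A - B) + (A ^ p - B ^ p) * B := by
      rw [pow_succ, pow_succ]; noncomm_ring
    have hpow : (p : ℝ) * L ^ (p - 1) * L = p * L ^ p := by
      cases p <;> simp [pow_succ, mul_assoc]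
    calc ‖A ^ (p + 1) - B ^ (p + 1)‖ ≤ ‖A‖ ^ p * ‖A - B‖ + ‖A ^ p - B ^ p‖ * ‖B‖ := by
          rw [hsplit]
          exact norm_add_le_of_le (norm_mul_le_of_le (norm_pow_le A p) le_rfl) (norm_mul_le _ _)
      _ ≤ L ^ p * ‖A - B‖ + (p * L ^ (p - 1) * ‖A - B‖) * L := by gcongr
      _ = L ^ p * ‖A - B‖ + (p * L ^ (p - 1) * L) * ‖A - B‖ := by ring
      _ = _ := by rw [hpow, add_tsub_cancel_right]; push_cast; ring

variable [NormedAlgebra ℝ 𝔸]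

lemma norm_smul_pow_le (hc : ∀ p, 0 ≤ c (p + 1)) (hA : ‖A‖ ≤ L) (p : ℕ) :
    ‖c (p + 1) • A ^ p‖ ≤ c (p + 1) * L ^ p := by
  rw [norm_smul, Real.norm_of_nonneg (hc p)]
  exact mul_le_mul_of_nonneg_left ((norm_pow_le A p).trans (by gcongr)) (hc p)

lemma norm_quotientSeries_le (hc : ∀ p, 0 ≤ c (p + 1)) (h : InsideConvergence c L)
    (hA : ‖A‖ ≤ L) : ‖quotientSeries c A‖ ≤ quotientSeries c L :=
  tsum_of_norm_bounded (h.summable hc ((norm_nonneg _).trans hA)).hasSum (norm_smul_pow_le hc hA)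

variable [CompleteSpace 𝔸]

lemma hasSum_quotientSeries (hc : ∀ p, 0 ≤ c (p + 1)) (h : InsideConvergence c L)
    (hA : ‖A‖ ≤ L) : HasSum (fun p : ℕ => c (p + 1) • A ^ p) (quotientSeries c A) :=
  (Summable.of_norm_bounded (h.summable hc ((norm_nonneg _).trans hA))
    (norm_smul_pow_le hc hA)).hasSum

lemma norm_quotientSeries_sub_le (hc : ∀ p, 0 ≤ c (p + 1)) (h : InsideConvergence c L)
    (hA : ‖A‖ ≤ L) (hB : ‖B‖ ≤ L) :
    ‖quotientSeries c A - quotientSeries c B‖ ≤ quotientSeriesDeriv c L * ‖A - B‖ := by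
  have hdiff := (hasSum_quotientSeries hc h hA).sub (hasSum_quotientSeries hc h hB)
  have hderiv := (h.summable_deriv hc ((norm_nonneg _).trans hA)).hasSum.mul_right ‖A - B‖
  rw [← hdiff.tsum_eq]
  refine tsum_of_norm_bounded hderiv fun p => ?_
  rw [← smul_sub, norm_smul, Real.norm_of_nonneg (hc p), mul_assoc]
  exact mul_le_mul_of_nonneg_left (norm_pow_sub_pow_le hA hB p) (hc p)

end NormedAlgebra

section PositiveOperator

variable {H : Type*} [NormedAddCommGroup H] [InnerProductSpace ℝ H] {A : H →L[ℝ] H}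

lemma norm_sq_apply_le_of_isPositive (hA : A.IsPositive) (u : H) :
    ‖A u‖ ^ 2 ≤ ‖A‖ * inner ℝ u (A u) := by
  have hcauchy : inner ℝ u (A (A u)) * inner ℝ (A u) (A u) ≤
      inner ℝ u (A u) * inner ℝ (A u) (A (A u)) :=
    LinearMap.BilinForm.apply_mul_apply_le_of_forall_zero_le
      ((innerₗ H).compl₂ A.toLinearMap) hA.inner_nonneg_right u (A u)
  rw [← hA.inner_left_eq_inner_right u (A u), real_inner_self_eq_norm_sq] at hcauchy
  have hnorm : inner ℝ (A u) (A (A u)) ≤ ‖A‖ * ‖A u‖ ^ 2 := by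
    calc inner ℝ (A u) (A (A u)) ≤ ‖A u‖ * (‖A‖ * ‖A u‖) :=
          (real_inner_le_norm _ _).trans (by gcongr; exact A.le_opNorm _)
      _ = ‖A‖ * ‖A u‖ ^ 2 := by ring
  have hnonneg : 0 ≤ inner ℝ u (A u) := hA.inner_nonneg_right u
  obtain hAu | hAu := (sq_nonneg ‖A u‖).eq_or_lt
  · rw [← hAu]; positivity
  · exact le_of_mul_le_mul_right (hcauchy.trans ((mul_le_mul_of_nonneg_left hnorm hnonneg).trans_eq
      (by ring))) hAu

variable [CompleteSpace H]

lemma isPositive_pow (hA : A.IsPositive) (p : ℕ) : (A ^ p).IsPositive := by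
  induction p using Nat.twoStepInduction with
  | zero => exact pow_zero A ▸ ContinuousLinearMap.isPositive_one
  | one => rwa [pow_one]
  | more p ih _ =>
    rw [pow_succ', pow_succ]
    have hconj := ih.conj_adjoint A
    rwa [hA.isSelfAdjoint.adjoint_eq] at hconj

variable [Nontrivial H] {c : ℕ → ℝ} {L : ℝ}

lemma hasSum_quotientSeries_apply (hc : ∀ p, 0 ≤ c (p + 1)) (h : InsideConvergence c L)
    (hA : ‖A‖ ≤ L) (v : H) :
    HasSum (fun p => c (p + 1) • (A ^ p) v) (quotientSeries c A v) :=
  (hasSum_quotientSeries hc h hA).mapL (ContinuousLinearMap.apply ℝ H v)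

lemma hasSum_inner_quotientSeries_apply (hc : ∀ p, 0 ≤ c (p + 1)) (h : InsideConvergence c L)
    (hA : ‖A‖ ≤ L) (u v : H) :
    HasSum (fun p => c (p + 1) * inner ℝ u ((A ^ p) v)) (inner ℝ u (quotientSeries c A v)) := by
  simpa [inner_smul_right] using
    (hasSum_quotientSeries_apply hc h hA v).mapL (innerSL ℝ u)

lemma quotientSeries_apply_of_apply_eq_smul (hc : ∀ p, 0 ≤ c (p + 1)) (h : InsideConvergence c L)
    (hA : ‖A‖ ≤ L) {v : H} {t : ℝ} (ht : ‖t‖ ≤ L) (hv : A v = t • v) :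
    quotientSeries c A v = quotientSeries c t • v := by
  have hpow (p : ℕ) : (A ^ p) v = t ^ p • v := by
    induction p with
    | zero => simp
    | succ p ih =>
      rw [pow_succ, mul_apply_eq_comp, hv, map_smul, ih, smul_smul, pow_succ']
  refine (hasSum_quotientSeries_apply hc h hA v).unique ?_
  simpa [hpow, smul_smul] using (hasSum_quotientSeries hc h ht).smul_const v

lemma isPositive_quotientSeries (hc : ∀ p, 0 ≤ c (p + 1)) (h : InsideConvergence c L)
    (hA : ‖A‖ ≤ L) (hpos : A.IsPositive) : (quotientSeries c A).IsPositive := by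
  refine (ContinuousLinearMap.isPositive_iff _).2 ⟨fun u v => ?_, fun u => ?_⟩
  · rw [ContinuousLinearMap.coe_coe, real_inner_comm]
    refine (hasSum_inner_quotientSeries_apply hc h hA v u).unique
      ((hasSum_inner_quotientSeries_apply hc h hA u v).congr_fun fun p => ?_)
    rw [← (isPositive_pow hpos p).inner_left_eq_inner_right, real_inner_comm]
  · rw [real_inner_comm]
    exact (hasSum_inner_quotientSeries_apply hc h hA u u).nonneg fun p =>
      mul_nonneg (hc p) ((isPositive_pow hpos p).inner_nonneg_right u)

end PositiveOperator

section LargestEigenvalue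

variable {N : ℕ} {A : Matrix (Fin N) (Fin N) ℝ}

lemma le_largestEigenvalue {t : ℝ} (h : Module.End.HasEigenvalue (Matrix.toLin' A) t) :
    t ≤ largestEigenvalue A :=
  le_csSup (Module.End.finite_hasEigenvalue _).bddAbove h

lemma largestEigenvalue_nonneg (hA : A.PosSemidef) : 0 ≤ largestEigenvalue A := by
  refine Real.sSup_nonneg fun t ht => ?_
  obtain ⟨v, hv⟩ := Module.End.HasEigenvalue.exists_hasEigenvector ht
  have hAv : A *ᵥ v = t • v := hv.apply_eq_smul
  have hform := hA.dotProduct_mulVec_nonneg v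
  rw [hAv, dotProduct_smul, smul_eq_mul, star_trivial] at hform
  exact nonneg_of_mul_nonneg_left hform (dotProduct_self_star_pos_iff.2 hv.2)

lemma posSemidef_largestEigenvalue_smul_one_sub (hA : A.IsHermitian) :
    (largestEigenvalue A • (1 : Matrix (Fin N) (Fin N) ℝ) - A).PosSemidef := by
  have hB : (largestEigenvalue A • (1 : Matrix (Fin N) (Fin N) ℝ) - A).IsHermitian :=
    (isHermitian_one.smul (IsSelfAdjoint.all _)).sub hA
  rw [hB.posSemidef_iff_eigenvalues_nonneg]
  intro i
  have hv := hB.mulVec_eigenvectorBasis i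
  rw [sub_mulVec, smul_mulVec, one_mulVec] at hv
  have hAv : A *ᵥ ⇑(hB.eigenvectorBasis i) =
      (largestEigenvalue A - hB.eigenvalues i) • ⇑(hB.eigenvectorBasis i) := by
    rw [sub_smul, ← hv, sub_sub_cancel]
  have hne : ⇑(hB.eigenvectorBasis i) ≠ 0 := fun h₀ =>
    hB.eigenvectorBasis.orthonormal.ne_zero i (by ext j; exact congrFun h₀ j)
  have hle := le_largestEigenvalue
    (Module.End.hasEigenvalue_of_hasEigenvector ⟨Module.End.mem_eigenspace_iff.2 hAv, hne⟩)
  rwa [sub_le_self_iff] at hle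

lemma dotProduct_mulVec_le_largestEigenvalue_mul (hA : A.IsHermitian) (b : Fin N → ℝ) :
    b ⬝ᵥ A *ᵥ b ≤ largestEigenvalue A * (b ⬝ᵥ b) := by
  have h := (posSemidef_largestEigenvalue_smul_one_sub hA).dotProduct_mulVec_nonneg b
  rwa [sub_mulVec, smul_mulVec, one_mulVec, dotProduct_sub, dotProduct_smul, smul_eq_mul,
    star_trivial, sub_nonneg] at h

end LargestEigenvalue

section OperatorKernel

variable {X H : Type*} [NormedAddCommGroup H] [InnerProductSpace ℝ H] {N : ℕ}

/-- The kernel `⟨φ(x), S φ(z)⟩` of a feature map twisted by an operator on the feature space. With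
`T` and `T̂` the covariance operators of `φ`, the kernels `k`, `k_s` and `k̂_s` are obtained for
`S = 1`, `S = s(T) / T` and `S = s(T̂) / T̂`. -/
def operatorKernel (φ : X → H) (S : H →L[ℝ] H) (x z : X) : ℝ :=
  inner ℝ (φ x) (S (φ z))

lemma kvec_operatorKernel_dotProduct (φ : X → H) (S : H →L[ℝ] H) (x : Fin N → X) (z : X)
    (b : Fin N → ℝ) : kvec (operatorKernel φ S) x z ⬝ᵥ b =
      inner ℝ (φ z) (S (Fintype.linearCombination ℝ (φ ∘ x) b)) := by
  simp [Fintype.linearCombination_apply, dotProduct, kvec, operatorKernel, inner_sum,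
    inner_smul_right, mul_comm]

lemma dotProduct_gram_operatorKernel_mulVec (φ : X → H) (S : H →L[ℝ] H) (x : Fin N → X)
    (a b : Fin N → ℝ) : a ⬝ᵥ gram (operatorKernel φ S) x *ᵥ b =
      inner ℝ (Fintype.linearCombination ℝ (φ ∘ x) a)
        (S (Fintype.linearCombination ℝ (φ ∘ x) b)) := by
  have hrow (i : Fin N) : (gram (operatorKernel φ S) x *ᵥ b) i =
      inner ℝ (φ (x i)) (S (Fintype.linearCombination ℝ (φ ∘ x) b)) :=
    kvec_operatorKernel_dotProduct φ S x (x i) b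
  simp [dotProduct, hrow, Fintype.linearCombination_apply ℝ (φ ∘ x) a, sum_inner, inner_smul_left]

lemma posSemidef_gram_operatorKernel (φ : X → H) {S : H →L[ℝ] H} (hS : S.IsPositive)
    (x : Fin N → X) : (gram (operatorKernel φ S) x).PosSemidef := by
  refine .of_dotProduct_mulVec_nonneg (Matrix.IsHermitian.ext fun i j => ?_) fun a => ?_
  · change inner ℝ (φ (x j)) (S (φ (x i))) = inner ℝ (φ (x i)) (S (φ (x j)))
    rw [← hS.inner_left_eq_inner_right, real_inner_comm]
  · rw [star_trivial, dotProduct_gram_operatorKernel_mulVec]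
    exact hS.inner_nonneg_right _

lemma empiricalCovariance_apply_eq_linearCombination (φ : X → H) (x : Fin N → X) (v : H) :
    empiricalCovariance φ x v =
      (N : ℝ)⁻¹ • Fintype.linearCombination ℝ (φ ∘ x) fun i => inner ℝ (φ (x i)) v := by
  simp [empiricalCovariance_apply, Fintype.linearCombination_apply]

lemma norm_empiricalCovariance_le (φ : X → H) (x : Fin N → X) :
    ‖empiricalCovariance φ x‖ ≤
      largestEigenvalue ((N : ℝ)⁻¹ • gram (operatorKernel φ 1) x) := by
  set l := largestEigenvalue ((N : ℝ)⁻¹ • gram (operatorKernel φ 1) x)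
  have hG : ((N : ℝ)⁻¹ • gram (operatorKernel φ 1) x).PosSemidef :=
    (posSemidef_gram_operatorKernel φ ContinuousLinearMap.isPositive_one x).smul (by positivity)
  have hl : 0 ≤ l := largestEigenvalue_nonneg hG
  refine ContinuousLinearMap.opNorm_le_bound _ hl fun u => ?_
  set b : Fin N → ℝ := fun i => inner ℝ (φ (x i)) u
  set w := empiricalCovariance φ x u
  have hquad : ‖w‖ ^ 2 = (N : ℝ)⁻¹ * (b ⬝ᵥ ((N : ℝ)⁻¹ • gram (operatorKernel φ 1) x) *ᵥ b) := by
    rw [smul_mulVec, dotProduct_smul, dotProduct_gram_operatorKernel_mulVec, one_apply_eq_self,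
      real_inner_self_eq_norm_sq,
      show w = _ from empiricalCovariance_apply_eq_linearCombination φ x u, norm_smul, norm_inv,
      RCLike.norm_natCast, smul_eq_mul]
    ring
  have hinner : inner ℝ u w = (N : ℝ)⁻¹ * (b ⬝ᵥ b) := inner_empiricalCovariance_apply φ x u u
  have hsq : ‖w‖ * ‖w‖ ≤ l * ‖u‖ * ‖w‖ := by
    calc ‖w‖ * ‖w‖ ≤ (N : ℝ)⁻¹ * (l * (b ⬝ᵥ b)) := by
          rw [← sq, hquad]
          gcongr
          exact dotProduct_mulVec_le_largestEigenvalue_mul hG.1 b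
      _ = l * inner ℝ u w := by rw [hinner]; ring
      _ ≤ l * (‖u‖ * ‖w‖) := by gcongr; exact real_inner_le_norm u w
      _ = l * ‖u‖ * ‖w‖ := by ring
  obtain hw | hw := (norm_nonneg w).eq_or_lt
  · rw [← hw]; positivity
  · exact le_of_mul_le_mul_right hsq hw

lemma empiricalCovariance_pow_succ_apply (φ : X → H) (x : Fin N → X) (w : X) (p : ℕ) :
    (empiricalCovariance φ x ^ (p + 1)) (φ w) = ((N : ℝ) ^ (p + 1))⁻¹ •
      Fintype.linearCombination ℝ (φ ∘ x)
        (gram (operatorKernel φ 1) x ^ p *ᵥ kvec (operatorKernel φ 1) x w) := by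
  induction p with
  | zero =>
    have hkvec : kvec (operatorKernel φ 1) x w = fun i => inner ℝ (φ (x i)) (φ w) :=
      funext fun i => real_inner_comm _ _
    simp [empiricalCovariance_apply_eq_linearCombination, hkvec]
  | succ p ih =>
    have hcoeff (b : Fin N → ℝ) :
        (fun i => inner ℝ (φ (x i)) (Fintype.linearCombination ℝ (φ ∘ x) b)) =
          gram (operatorKernel φ 1) x *ᵥ b :=
      funext fun i => (kvec_operatorKernel_dotProduct φ 1 x (x i) b).symm
    rw [pow_succ', mul_apply_eq_comp, ih, map_smul, empiricalCovariance_apply_eq_linearCombination,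
      hcoeff, mulVec_mulVec, ← pow_succ', smul_smul, ← mul_inv, ← pow_succ]

lemma empiricalPower_operatorKernel_one (φ : X → H) (x : Fin N → X) (p : ℕ) (u w : X) :
    empiricalPower (operatorKernel φ 1) x (p + 1) u w =
      operatorKernel φ (empiricalCovariance φ x ^ p) u w := by
  cases p with
  | zero => rfl
  | succ p =>
    rw [operatorKernel, empiricalCovariance_pow_succ_apply, real_inner_smul_right,
      ← div_eq_inv_mul]
    exact congrArg (· / _) (kvec_operatorKernel_dotProduct φ 1 x u _)

lemma empiricalStk_operatorKernel_one [CompleteSpace H] [Nontrivial H] (φ : X → H) {c : ℕ → ℝ}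
    {L : ℝ} (hc : ∀ p, 0 ≤ c (p + 1)) (h : InsideConvergence c L) {x : Fin N → X}
    (hx : ‖empiricalCovariance φ x‖ ≤ L) : empiricalStk c (operatorKernel φ 1) x =
      operatorKernel φ (quotientSeries c (empiricalCovariance φ x)) := by
  ext u w
  simp_rw [empiricalStk, empiricalPower_operatorKernel_one]
  exact (hasSum_inner_quotientSeries_apply hc h hx _ _).tsum_eq

end OperatorKernel

section Ridge

variable {ι : Type*} [Fintype ι] [DecidableEq ι] {G G' : Matrix ι ι ℝ} {ρ : ℝ}

/-- The ridge regression coefficients `(G + ρ I)⁻¹ y`. -/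
noncomputable def ridge (G : Matrix ι ι ℝ) (ρ : ℝ) (y : ι → ℝ) : ι → ℝ :=
  (G + ρ • (1 : Matrix ι ι ℝ))⁻¹ *ᵥ y

lemma mulVec_ridge_add_smul_ridge (hG : G.PosSemidef) (hρ : 0 < ρ) (y : ι → ℝ) :
    G *ᵥ ridge G ρ y + ρ • ridge G ρ y = y := by
  have hunit : IsUnit (G + ρ • (1 : Matrix ι ι ℝ)) :=
    ((PosDef.one.smul hρ).posSemidef_add hG).isUnit
  calc G *ᵥ ridge G ρ y + ρ • ridge G ρ y = (G + ρ • 1) *ᵥ ridge G ρ y := by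
        rw [add_mulVec, smul_mulVec, one_mulVec]
    _ = y := by
        rw [ridge, mulVec_mulVec, mul_nonsing_inv _ ((isUnit_iff_isUnit_det _).1 hunit), one_mulVec]

lemma sq_mul_dotProduct_ridge_le (hG : G.PosSemidef) (hρ : 0 < ρ) (y : ι → ℝ) :
    ρ ^ 2 * (ridge G ρ y ⬝ᵥ ridge G ρ y) ≤ y ⬝ᵥ y := by
  set a := ridge G ρ y
  have hexpand : y ⬝ᵥ y = G *ᵥ a ⬝ᵥ G *ᵥ a + 2 * ρ * (a ⬝ᵥ G *ᵥ a) + ρ ^ 2 * (a ⬝ᵥ a) := by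
    rw [← mulVec_ridge_add_smul_ridge hG hρ y]
    simp only [add_dotProduct, dotProduct_add, smul_dotProduct, dotProduct_smul, smul_eq_mul,
      dotProduct_comm (G *ᵥ ridge G ρ y) (ridge G ρ y), a]
    ring
  have hGa : 0 ≤ a ⬝ᵥ G *ᵥ a := hG.dotProduct_mulVec_nonneg a
  have hsq : 0 ≤ G *ᵥ a ⬝ᵥ G *ᵥ a := dotProduct_self_star_nonneg _
  rw [hexpand]
  linarith [mul_nonneg (mul_nonneg zero_le_two hρ.le) hGa]

lemma ridge_sub_dotProduct_mulVec_le (hG : G.PosSemidef) (hG' : G'.PosSemidef) (hρ : 0 < ρ)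
    (y : ι → ℝ) :
    (ridge G' ρ y - ridge G ρ y) ⬝ᵥ G *ᵥ (ridge G' ρ y - ridge G ρ y) ≤
      (ridge G' ρ y - ridge G ρ y) ⬝ᵥ (G - G') *ᵥ ridge G' ρ y := by
  set d := ridge G' ρ y - ridge G ρ y with hd
  have hsub : (G - G') *ᵥ ridge G' ρ y = G *ᵥ d + ρ • d := by
    have heq := (mulVec_ridge_add_smul_ridge hG hρ y).trans
      (mulVec_ridge_add_smul_ridge hG' hρ y).symm
    rw [sub_mulVec, hd, mulVec_sub, smul_sub, ← sub_eq_zero]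
    rw [← sub_eq_zero] at heq
    rw [← heq]
    abel
  have hdd : 0 ≤ d ⬝ᵥ d := dotProduct_self_star_nonneg d
  rw [hsub, dotProduct_add, dotProduct_smul, smul_eq_mul]
  linarith [mul_nonneg hρ.le hdd]

end Ridge

section KernelRidgeRegression

variable {X H : Type*} [NormedAddCommGroup H] [InnerProductSpace ℝ H] {κ L g R : ℝ}

lemma norm_sq_linearCombination_le {ι : Type*} [Fintype ι] {v : ι → H}
    (hv : ∀ i, ‖v i‖ ^ 2 ≤ κ ^ 2) (a : ι → ℝ) :
    ‖Fintype.linearCombination ℝ v a‖ ^ 2 ≤ Fintype.card ι * κ ^ 2 * (a ⬝ᵥ a) := by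
  calc ‖Fintype.linearCombination ℝ v a‖ ^ 2 ≤ (∑ i, |a i| * ‖v i‖) ^ 2 := by
        rw [Fintype.linearCombination_apply]
        gcongr
        exact norm_sum_le_of_le _ fun i _ => (norm_smul _ _).le
    _ ≤ (∑ i, |a i| ^ 2) * ∑ i, ‖v i‖ ^ 2 := Finset.sum_mul_sq_le_sq_mul_sq _ _ _
    _ ≤ (∑ i, |a i| ^ 2) * (Fintype.card ι * κ ^ 2) := by
        gcongr
        exact (Finset.sum_le_card_nsmul _ _ _ fun i _ => hv i).trans_eq (nsmul_eq_mul _ _)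
    _ = Fintype.card ι * κ ^ 2 * (a ⬝ᵥ a) := by
        simp only [sq_abs, sq (a _), dotProduct]
        ring

/-- The combination `∑ i, a i • φ (x i)` of the features of the samples whose coefficients are those
of kernel ridge regression with the kernel `operatorKernel φ S`. The predictor is the inner product
with the image of this vector under `S`. -/
noncomputable def ridgeVector {n : ℕ} (φ : X → H) (S : H →L[ℝ] H) (β : ℝ) (x : Fin n → X)
    (y : Fin n → ℝ) : H :=
  Fintype.linearCombination ℝ (φ ∘ x) (ridge (gram (operatorKernel φ S) x) (n * β) y)

variable {n : ℕ} {φ : X → H} {S S' T : H →L[ℝ] H} {β : ℝ} {x : Fin n → X}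

lemma krr_operatorKernel (φ : X → H) (S : H →L[ℝ] H) (β : ℝ) (x : Fin n → X) (y : Fin n → ℝ)
    (z : X) : krr (operatorKernel φ S) β x y z = inner ℝ (φ z) (S (ridgeVector φ S β x y)) :=
  kvec_operatorKernel_dotProduct φ S x z _

lemma krr_operatorKernel_sub (φ : X → H) (S S' : H →L[ℝ] H) (β : ℝ) (x : Fin n → X)
    (y : Fin n → ℝ) (z : X) :
    krr (operatorKernel φ S') β x y z - krr (operatorKernel φ S) β x y z =
      inner ℝ (φ z) (S' (ridgeVector φ S' β x y) - S (ridgeVector φ S β x y)) := by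
  rw [krr_operatorKernel, krr_operatorKernel, inner_sub_right]

lemma norm_sq_ridgeVector_le (hS : S.IsPositive) (hn : 0 < n) (hβ : 0 < β)
    (hx : ∀ i, ‖φ (x i)‖ ^ 2 ≤ κ ^ 2) (y : Fin n → ℝ) :
    ‖ridgeVector φ S β x y‖ ^ 2 ≤ κ ^ 2 * (∑ i, y i ^ 2) / (n * β ^ 2) := by
  set a := ridge (gram (operatorKernel φ S) x) (n * β) y
  have hy : y ⬝ᵥ y = ∑ i, y i ^ 2 := by simp only [dotProduct, sq]
  have ha : (n * β) ^ 2 * (a ⬝ᵥ a) ≤ ∑ i, y i ^ 2 :=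
    hy ▸ sq_mul_dotProduct_ridge_le (posSemidef_gram_operatorKernel φ hS x) (by positivity) y
  have hv := norm_sq_linearCombination_le (v := φ ∘ x) hx a
  rw [Fintype.card_fin] at hv
  rw [le_div_iff₀ (by positivity)]
  calc ‖ridgeVector φ S β x y‖ ^ 2 * (n * β ^ 2) ≤ n * κ ^ 2 * (a ⬝ᵥ a) * (n * β ^ 2) := by
        gcongr
        exact hv
    _ = κ ^ 2 * ((n * β) ^ 2 * (a ⬝ᵥ a)) := by ring
    _ ≤ κ ^ 2 * ∑ i, y i ^ 2 := by gcongr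

lemma inner_ridgeVector_sub_le (hS : S.IsPositive) (hS' : S'.IsPositive) (hn : 0 < n)
    (hβ : 0 < β) (y : Fin n → ℝ) :
    inner ℝ (ridgeVector φ S' β x y - ridgeVector φ S β x y)
        (S (ridgeVector φ S' β x y - ridgeVector φ S β x y)) ≤
      inner ℝ (ridgeVector φ S' β x y - ridgeVector φ S β x y)
        ((S - S') (ridgeVector φ S' β x y)) := by
  have hgram : gram (operatorKernel φ S) x - gram (operatorKernel φ S') x =
      gram (operatorKernel φ (S - S')) x := by
    ext i j
    simp [gram, operatorKernel, inner_sub_right]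
  have h := ridge_sub_dotProduct_mulVec_le (posSemidef_gram_operatorKernel φ hS x)
    (posSemidef_gram_operatorKernel φ hS' x) (ρ := n * β) (by positivity) y
  rwa [hgram, dotProduct_gram_operatorKernel_mulVec, dotProduct_gram_operatorKernel_mulVec,
    map_sub] at h

lemma inner_add_apply_add_le (hT : T.IsPositive) (a b : H) :
    inner ℝ (a + b) (T (a + b)) ≤ 2 * inner ℝ a (T a) + 2 * inner ℝ b (T b) := by
  have h := hT.inner_nonneg_right (a - b)
  simp only [map_add, map_sub, inner_add_left, inner_add_right, inner_sub_left,
    inner_sub_right] at h ⊢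
  linarith

lemma inner_apply_self_le (hT : ‖T‖ ≤ L) (a : H) : inner ℝ a (T a) ≤ L * ‖a‖ ^ 2 := by
  calc inner ℝ a (T a) ≤ ‖a‖ * (L * ‖a‖) :=
        (real_inner_le_norm _ _).trans (by gcongr; exact T.le_of_opNorm_le hT a)
    _ = L * ‖a‖ ^ 2 := by ring

lemma inner_le_two_mul_norm_mul {u v : H} (A : H →L[ℝ] H) (hu : ‖u‖ ^ 2 ≤ R)
    (hv : ‖v‖ ^ 2 ≤ R) : inner ℝ (u - v) (A u) ≤ 2 * ‖A‖ * R := by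
  calc inner ℝ (u - v) (A u) ≤ ‖u - v‖ * ‖A u‖ := real_inner_le_norm _ _
    _ ≤ (‖u‖ + ‖v‖) * (‖A‖ * ‖u‖) := by
        gcongr
        exacts [norm_sub_le u v, A.le_opNorm u]
    _ = ‖A‖ * ((‖u‖ + ‖v‖) * ‖u‖) := by ring
    _ ≤ ‖A‖ * (2 * R) := by
        have huv : (‖u‖ + ‖v‖) * ‖u‖ ≤ 2 * R := by linarith [sq_nonneg (‖u‖ - ‖v‖)]
        gcongr
    _ = 2 * ‖A‖ * R := by ring

lemma inner_apply_sub_apply_le [CompleteSpace H] (hT : T.IsPositive) (hS : S.IsPositive)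
    (hTL : ‖T‖ ≤ L) (hSg : ‖S‖ ≤ g) (hSg' : ‖S'‖ ≤ g) {u v : H} (hu : ‖u‖ ^ 2 ≤ R)
    (hv : ‖v‖ ^ 2 ≤ R) (huv : inner ℝ (u - v) (S (u - v)) ≤ inner ℝ (u - v) ((S - S') u)) :
    inner ℝ (S' u - S v) (T (S' u - S v)) ≤ 8 * (L * g) * ‖S' - S‖ * R := by
  have hL : 0 ≤ L := (norm_nonneg T).trans hTL
  have hg : 0 ≤ g := (norm_nonneg S).trans hSg
  have hdiff : ‖S' - S‖ ≤ 2 * g := (norm_sub_le _ _).trans (by linarith)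
  have hsplit : S' u - S v = (S' - S) u + S (u - v) := by
    rw [_root_.sub_apply, map_sub]
    abel
  have hoperator : inner ℝ ((S' - S) u) (T ((S' - S) u)) ≤ 2 * (L * g) * ‖S' - S‖ * R :=
    calc inner ℝ ((S' - S) u) (T ((S' - S) u)) ≤ L * (‖S' - S‖ * ‖u‖) ^ 2 :=
          (inner_apply_self_le hTL _).trans (by gcongr; exact (S' - S).le_opNorm u)
      _ = L * ‖S' - S‖ * (‖S' - S‖ * ‖u‖ ^ 2) := by ring
      _ ≤ L * ‖S' - S‖ * (2 * g * R) := by gcongr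
      _ = 2 * (L * g) * ‖S' - S‖ * R := by ring
  have hvector : inner ℝ (S (u - v)) (T (S (u - v))) ≤ 2 * (L * g) * ‖S' - S‖ * R :=
    calc inner ℝ (S (u - v)) (T (S (u - v))) ≤ L * (‖S‖ * inner ℝ (u - v) (S (u - v))) :=
          (inner_apply_self_le hTL _).trans
            (by gcongr; exact norm_sq_apply_le_of_isPositive hS (u - v))
      _ ≤ L * (g * (2 * ‖S - S'‖ * R)) := by
          have hnonneg := hS.inner_nonneg_right (u - v)
          gcongr
          exact huv.trans (inner_le_two_mul_norm_mul _ hu hv)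
      _ = 2 * (L * g) * ‖S' - S‖ * R := by rw [norm_sub_rev]; ring
  rw [hsplit]
  linarith [inner_add_apply_add_le hT ((S' - S) u) (S (u - v))]

variable [MeasurableSpace X] {P : Measure X}

lemma integral_inner_sq [CompleteSpace H] (hφ : MemLp φ 2 P) (w : H) :
    ∫ z, inner ℝ (φ z) w ^ 2 ∂P = inner ℝ w (covariance P φ w) := by
  simp only [inner_covariance_apply hφ, sq]

lemma memLp_krr_operatorKernel_sub (hφ : MemLp φ 2 P) (S S' : H →L[ℝ] H) (β : ℝ)
    (x : Fin n → X) (y : Fin n → ℝ) :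
    MemLp (fun z => krr (operatorKernel φ S') β x y z - krr (operatorKernel φ S) β x y z) 2 P := by
  simp only [krr_operatorKernel_sub]
  exact hφ.inner_const _

lemma integral_krr_operatorKernel_sub_sq_le [CompleteSpace H] (hφ : MemLp φ 2 P)
    (hS : S.IsPositive) (hS' : S'.IsPositive) (hL : ‖covariance P φ‖ ≤ L) (hSg : ‖S‖ ≤ g)
    (hSg' : ‖S'‖ ≤ g) (hn : 0 < n) (hβ : 0 < β) (hx : ∀ i, ‖φ (x i)‖ ^ 2 ≤ κ ^ 2)
    (y : Fin n → ℝ) :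
    ∫ z, (krr (operatorKernel φ S') β x y z - krr (operatorKernel φ S) β x y z) ^ 2 ∂P ≤
      8 * (L * g) * ‖S' - S‖ * (κ ^ 2 * (∑ i, y i ^ 2) / (n * β ^ 2)) := by
  simp only [krr_operatorKernel_sub, integral_inner_sq hφ]
  exact inner_apply_sub_apply_le (isPositive_covariance hφ) hS hL hSg hSg'
    (norm_sq_ridgeVector_le hS' hn hβ hx y) (norm_sq_ridgeVector_le hS hn hβ hx y)
    (inner_ridgeVector_sub_le hS hS' hn hβ y)

lemma integral_krr_quotientSeries_sub_sq_le [CompleteSpace H] [Nontrivial H] {N : ℕ} {c : ℕ → ℝ}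
    (hφ : MemLp φ 2 P) (hc : ∀ p, 0 ≤ c (p + 1)) (h : InsideConvergence c L)
    (hL : ‖covariance P φ‖ ≤ L) {w : Fin N → X} (hw : ‖empiricalCovariance φ w‖ ≤ L)
    (hn : 0 < n) (hβ : 0 < β) (hx : ∀ i, ‖φ (x i)‖ ^ 2 ≤ κ ^ 2) (y : Fin n → ℝ) :
    ∫ z, (krr (operatorKernel φ (quotientSeries c (empiricalCovariance φ w))) β x y z -
        krr (operatorKernel φ (quotientSeries c (covariance P φ))) β x y z) ^ 2 ∂P ≤
      8 * (transform c L * quotientSeriesDeriv c L) * ‖empiricalCovariance φ w - covariance P φ‖ *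
        (κ ^ 2 * (∑ i, y i ^ 2) / (n * β ^ 2)) := by
  have hL₀ : 0 ≤ L := (norm_nonneg _).trans hL
  have hs : 0 ≤ transform c L := transform_nonneg hc hL₀
  refine (integral_krr_operatorKernel_sub_sq_le hφ
    (isPositive_quotientSeries hc h hL (isPositive_covariance hφ))
    (isPositive_quotientSeries hc h hw (isPositive_empiricalCovariance φ w)) hL
    (norm_quotientSeries_le hc h hL) (norm_quotientSeries_le hc h hw) hn hβ hx y).trans ?_
  rw [← transform_eq_mul_quotientSeries, ← mul_assoc 8, mul_assoc (8 * transform c L) _ ‖_‖]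
  gcongr
  exact norm_quotientSeries_sub_le hc h hw hL

end KernelRidgeRegression

section Feature

/-- The Hilbert space of square summable real sequences, in which the features of a kernel with a
spectral expansion live. -/
abbrev SeqSpace : Type := lp (fun _ : ℕ => ℝ) 2

instance : Nontrivial SeqSpace :=
  ⟨lp.single 2 0 1, 0, fun h => by simpa using congrArg (fun f : SeqSpace => f 0) h⟩

lemma hasSum_mul_apply (u v : SeqSpace) : HasSum (fun i => u i * v i) (inner ℝ u v) := by
  simpa [mul_comm] using lp.hasSum_inner (𝕜 := ℝ) u v

lemma inner_single_one_left (i : ℕ) (v : SeqSpace) :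
    inner ℝ (lp.single 2 i (1 : ℝ) : SeqSpace) v = v i := by
  simp [lp.inner_single_left]

lemma apply_apply_eq_mul_of_isPositive {A : SeqSpace →L[ℝ] SeqSpace} (hA : A.IsPositive) {i : ℕ}
    {t : ℝ} (h : A (lp.single 2 i 1) = t • lp.single 2 i 1) (v : SeqSpace) :
    A v i = t * v i := by
  rw [← inner_single_one_left, ← hA.inner_left_eq_inner_right, h, real_inner_smul_left,
    inner_single_one_left]

variable {X : Type*} [MeasurableSpace X] {P : Measure X} {k : X → X → ℝ} {lam : ℕ → ℝ}
  {e : ℕ → X → ℝ}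

/-- The feature map `x ↦ (√λ_i e_i(x))_i` of a kernel with a spectral expansion. -/
noncomputable def feature (hk : IsSpectralExpansion P k lam e) (x : X) : SeqSpace :=
  ⟨fun i => √(lam i) * e i x, memℓp_gen <| (hk.hasSum x x).summable.congr fun i => by
    rw [ENNReal.toReal_ofNat, Real.rpow_two, Real.norm_eq_abs, sq_abs, mul_pow,
      Real.sq_sqrt (hk.nonneg i)]
    ring⟩

lemma feature_apply (hk : IsSpectralExpansion P k lam e) (x : X) (i : ℕ) :
    feature hk x i = √(lam i) * e i x := rfl

lemma inner_feature (hk : IsSpectralExpansion P k lam e) (x z : X) :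
    inner ℝ (feature hk x) (feature hk z) = k x z := by
  refine (hasSum_mul_apply _ _).unique ((hk.hasSum x z).congr_fun fun i => ?_)
  rw [feature_apply, feature_apply]
  linear_combination e i x * e i z * Real.mul_self_sqrt (hk.nonneg i)

lemma operatorKernel_feature_one (hk : IsSpectralExpansion P k lam e) :
    operatorKernel (feature hk) 1 = k :=
  funext fun x => funext fun z => inner_feature hk x z

lemma norm_sq_feature (hk : IsSpectralExpansion P k lam e) (x : X) :
    ‖feature hk x‖ ^ 2 = k x x := by
  rw [← real_inner_self_eq_norm_sq, inner_feature]

lemma stronglyMeasurable_feature (hk : IsSpectralExpansion P k lam e) :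
    StronglyMeasurable (feature hk) := by
  have hsum (x : X) : HasSum (fun i => feature hk x i • (lp.single 2 i 1 : SeqSpace))
      (feature hk x) := by
    simpa [← lp.single_smul] using lp.hasSum_single (by norm_num) (feature hk x)
  refine stronglyMeasurable_of_tendsto Filter.atTop
    (f := fun (n : ℕ) x => ∑ i ∈ Finset.range n, feature hk x i • (lp.single 2 i 1 : SeqSpace))
    (fun n => Finset.stronglyMeasurable_fun_sum _ fun i _ => ?_)
    (tendsto_pi_nhds.2 fun x => (hsum x).tendsto_sum_nat)
  exact ((hk.measurable i).const_mul √(lam i)).stronglyMeasurable.smul_const _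

lemma integral_feature_apply_mul_feature_apply (hk : IsSpectralExpansion P k lam e) (i j : ℕ) :
    ∫ x, feature hk x i * feature hk x j ∂P = if i = j then lam i else 0 := by
  have hpoint (x : X) : feature hk x i * feature hk x j =
      √(lam i) * √(lam j) * (e i x * e j x) := mul_mul_mul_comm ..
  simp only [hpoint, integral_const_mul]
  by_cases hi : lam i = 0
  · simp [hi]
  by_cases hj : lam j = 0
  · simp +contextual [hj]
  rw [hk.orthonormal i j hi hj]
  split_ifs with hij
  · rw [← hij, mul_one, Real.mul_self_sqrt (hk.nonneg i)]
  · rw [mul_zero]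

lemma covariance_feature_single (hk : IsSpectralExpansion P k lam e)
    (hφ : MemLp (feature hk) 2 P) (i : ℕ) :
    covariance P (feature hk) (lp.single 2 i 1) = lam i • lp.single 2 i 1 := by
  ext j
  have hentry : covariance P (feature hk) (lp.single 2 i 1) j = if j = i then lam j else 0 := by
    rw [← inner_single_one_left, inner_covariance_apply hφ,
      ← integral_feature_apply_mul_feature_apply hk]
    refine integral_congr_ae (.of_forall fun x => ?_)
    simp only [real_inner_comm _ (feature hk x), inner_single_one_left]
  rw [hentry]
  obtain rfl | hij := eq_or_ne j i <;> simp [*]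

lemma covariance_feature_apply (hk : IsSpectralExpansion P k lam e)
    (hφ : MemLp (feature hk) 2 P) (v : SeqSpace) (i : ℕ) :
    covariance P (feature hk) v i = lam i * v i :=
  apply_apply_eq_mul_of_isPositive (isPositive_covariance hφ) (covariance_feature_single hk hφ i) v

lemma norm_covariance_feature_le (hk : IsSpectralExpansion P k lam e)
    (hφ : MemLp (feature hk) 2 P) : ‖covariance P (feature hk)‖ ≤ lam 0 := by
  refine ContinuousLinearMap.opNorm_le_bound _ (hk.nonneg 0) fun v => ?_
  refine le_of_sq_le_sq ?_ (mul_nonneg (hk.nonneg 0) (norm_nonneg v))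
  rw [mul_pow, ← real_inner_self_eq_norm_sq, ← real_inner_self_eq_norm_sq]
  refine hasSum_le (fun i => ?_) (hasSum_mul_apply _ _) ((hasSum_mul_apply v v).mul_left _)
  have hle : lam i ^ 2 ≤ lam 0 ^ 2 :=
    pow_le_pow_left₀ (hk.nonneg i) (hk.antitone (Nat.zero_le i)) 2
  rw [covariance_feature_apply hk hφ, mul_mul_mul_comm, ← sq]
  exact mul_le_mul_of_nonneg_right hle (mul_self_nonneg _)

lemma norm_empiricalCovariance_feature_le (hk : IsSpectralExpansion P k lam e) {N : ℕ}
    (w : Fin N → X) : ‖empiricalCovariance (feature hk) w‖ ≤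
      largestEigenvalue ((N : ℝ)⁻¹ • gram k w) := by
  simpa only [operatorKernel_feature_one hk] using norm_empiricalCovariance_le (feature hk) w

lemma stk_transform_eq_operatorKernel (hk : IsSpectralExpansion P k lam e)
    (hφ : MemLp (feature hk) 2 P) {c : ℕ → ℝ} (hc : ∀ p, 0 ≤ c (p + 1)) {L : ℝ}
    (h : InsideConvergence c L) (hL : lam 0 ≤ L) :
    stk (transform c) lam e =
      operatorKernel (feature hk) (quotientSeries c (covariance P (feature hk))) := by
  have hT := (norm_covariance_feature_le hk hφ).trans hL
  have heigen (i : ℕ) : ‖lam i‖ ≤ L :=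
    (Real.norm_of_nonneg (hk.nonneg i)).trans_le ((hk.antitone (Nat.zero_le i)).trans hL)
  ext x z
  rw [stk, operatorKernel, ← (hasSum_mul_apply _ _).tsum_eq]
  refine tsum_congr fun i => ?_
  rw [apply_apply_eq_mul_of_isPositive
      (isPositive_quotientSeries hc h hT (isPositive_covariance hφ))
      (quotientSeries_apply_of_apply_eq_smul hc h hT (heigen i)
        (covariance_feature_single hk hφ i)),
    feature_apply, feature_apply, transform_eq_mul_quotientSeries]
  linear_combination -(quotientSeries c (lam i) * e i x * e i z) * Real.mul_self_sqrt (hk.nonneg i)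

lemma empiricalStk_eq_operatorKernel (hk : IsSpectralExpansion P k lam e) {c : ℕ → ℝ}
    (hc : ∀ p, 0 ≤ c (p + 1)) {L : ℝ} (h : InsideConvergence c L) {N : ℕ} {w : Fin N → X}
    (hw : largestEigenvalue ((N : ℝ)⁻¹ • gram k w) ≤ L) :
    empiricalStk c k w =
      operatorKernel (feature hk) (quotientSeries c (empiricalCovariance (feature hk) w)) := by
  have hT := (norm_empiricalCovariance_feature_le hk w).trans hw
  simpa only [operatorKernel_feature_one hk] using empiricalStk_operatorKernel_one _ hc h hT

end Feature

section Prediction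

variable {X : Type*} [MeasurableSpace X] {P : Measure X} {k : X → X → ℝ} {lam : ℕ → ℝ}
  {e : ℕ → X → ℝ} {c : ℕ → ℝ} {κ β L : ℝ} {N n : ℕ} {w : Fin N → X} {x : Fin n → X}

lemma memLp_krr_empiricalStk_sub_krr_stk (hk : IsSpectralExpansion P k lam e)
    (hφ : MemLp (feature hk) 2 P) (hc : ∀ p, 0 ≤ c (p + 1)) (h : InsideConvergence c L)
    (hlam : lam 0 ≤ L) (hw : largestEigenvalue ((N : ℝ)⁻¹ • gram k w) ≤ L) (β : ℝ)
    (x : Fin n → X) (y : Fin n → ℝ) :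
    MemLp (fun z => krr (empiricalStk c k w) β x y z - krr (stk (transform c) lam e) β x y z)
      2 P := by
  rw [stk_transform_eq_operatorKernel hk hφ hc h hlam, empiricalStk_eq_operatorKernel hk hc h hw]
  exact memLp_krr_operatorKernel_sub hφ ..

lemma integral_krr_empiricalStk_sub_krr_stk_sq_le (hk : IsSpectralExpansion P k lam e)
    (hφ : MemLp (feature hk) 2 P) (hc : ∀ p, 0 ≤ c (p + 1)) (h : InsideConvergence c L)
    (hlam : lam 0 ≤ L) (hw : largestEigenvalue ((N : ℝ)⁻¹ • gram k w) ≤ L) (hn : 0 < n)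
    (hβ : 0 < β) (hx : ∀ i, k (x i) (x i) ≤ κ ^ 2) (y : Fin n → ℝ) :
    ∫ z, (krr (empiricalStk c k w) β x y z - krr (stk (transform c) lam e) β x y z) ^ 2 ∂P ≤
      8 * (transform c L * quotientSeriesDeriv c L) *
        ‖empiricalCovariance (feature hk) w - covariance P (feature hk)‖ *
        (κ ^ 2 * (∑ i, y i ^ 2) / (n * β ^ 2)) := by
  rw [stk_transform_eq_operatorKernel hk hφ hc h hlam, empiricalStk_eq_operatorKernel hk hc h hw]
  exact integral_krr_quotientSeries_sub_sq_le hφ hc h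
    ((norm_covariance_feature_le hk hφ).trans hlam)
    ((norm_empiricalCovariance_feature_le hk w).trans hw) hn hβ
    (fun i => (norm_sq_feature hk (x i)).trans_le (hx i)) y

end Prediction

end STKR

theorem mainTheorem7 {X : Type*} [MeasurableSpace X] (P : Measure X) [IsProbabilityMeasure P]
    (k : X → X → ℝ) (lam : ℕ → ℝ) (e : ℕ → X → ℝ)
    (hk : STKR.IsSpectralExpansion P k lam e)
    (κ : ℝ) (hκ : ∀ᵐ x ∂P, k x x ≤ κ ^ 2)
    (c : ℕ → ℝ) (hc : ∀ p, 0 ≤ c (p + 1))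
    (m n : ℕ) (hn : 0 < n) (β : ℝ) (hβ : 0 < β)
    (δ : ℝ) (hδ₀ : 0 < δ) (hδ₁ : δ < 1) :
    ∃ E : Set (Fin (m + n) → X), MeasurableSet E ∧
      1 - δ ≤ (Measure.pi fun _ : Fin (m + n) => P).real E ∧
      ∀ x ∈ E, STKR.InsideConvergence c (STKR.lamMax k (lam 0) x) → ∀ y : Fin n → ℝ,
        let s : ℝ → ℝ := STKR.transform c
        let L : ℝ := STKR.lamMax k (lam 0) x
        let fTilde : X → ℝ := STKR.krr (STKR.stk s lam e) β (STKR.labeled x) y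
        let fHat : X → ℝ := STKR.krr (STKR.empiricalStk c k x) β (STKR.labeled x) y
        MemLp (fun z => fHat z - fTilde z) 2 P ∧
        ∫ z, (fHat z - fTilde z) ^ 2 ∂P ≤
          8 * s L * deriv (fun t => s t / t) L
            * ((β ^ 2)⁻¹ * κ ^ 4 / √((m : ℝ) + n))
            * (2 + √(2 * Real.log (1 / δ)))
            * ((∑ i, y i ^ 2) / n) := by
  have hκφ : ∀ᵐ x ∂P, ‖STKR.feature hk x‖ ^ 2 ≤ κ ^ 2 := by
    simpa only [STKR.norm_sq_feature] using hκ
  have hφ := STKR.memLp_two_of_ae_norm_sq_le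
    (STKR.stronglyMeasurable_feature hk).aestronglyMeasurable hκφ
  obtain ⟨E, hE, hPE, hgood⟩ :=
    STKR.exists_measurableSet_norm_empiricalCovariance_sub_covariance_le (N := m + n)
      hφ.1 hκφ (by lia) hδ₀ hδ₁.le
  simp only [STKR.norm_sq_feature, Nat.cast_add] at hgood
  refine ⟨E, hE, hPE, fun x hx hconv y => ?_⟩
  intro s L fTilde fHat
  obtain ⟨hbound, hdeviation⟩ := hgood x hx
  have hL : 0 ≤ L := (hk.nonneg 0).trans (le_max_left _ _)
  have hsg : 0 ≤ s L * STKR.quotientSeriesDeriv c L :=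
    mul_nonneg (STKR.transform_nonneg hc hL) (STKR.quotientSeriesDeriv_nonneg hc hL)
  refine ⟨STKR.memLp_krr_empiricalStk_sub_krr_stk hk hφ hc hconv (le_max_left _ _)
    (le_max_right _ _) β _ y, (STKR.integral_krr_empiricalStk_sub_krr_stk_sq_le hk hφ hc hconv
      (le_max_left _ _) (le_max_right _ _) hn hβ (fun i => hbound _) y).trans ?_⟩
  rw [mul_assoc 8 (s L), STKR.transform_mul_deriv_transform_div hc hconv hL]
  refine (mul_le_mul_of_nonneg_right (mul_le_mul_of_nonneg_left hdeviation (by positivity))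
    (by positivity)).trans_eq ?_
  field_simp
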